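/- Let $d\ge 1$, let $X\subset\mathbb R^d$ be closed and convex with $0\in X$, let $\Pi$ be the orthogonal projection onto $X$, let $b:\mathbb R^d\to\mathbb R^d$ be continuous with $b(0)=0$, and for $\gamma>0$ put $\mathcal T_\gamma(x)=x+\gamma b(x)$. Let $R_\gamma$ be the Markov kernel on $X$ of the projected Euler–Maruyama scheme $X_{k+1}=\Pi(\mathcal T_\gamma(X_k)+\sqrt\gamma Z_{k+1})$, with $Z_k$ i.i.d. standard Gaussian in $\mathbb R^d$. Let $K_\gamma$ be the Markov kernel on $X^2$ of its projected reflection coupling: with $E=\mathcal T_\gamma(y)-\mathcal T_\gamma(x)$, $e=E/\|E\|$, $Z$ standard Gaussian, $U$ uniform on $[0,1]$ independent of $Z$, $z=\sqrt\gamma Z$ and $\varphi_\gamma$ the density of $N(0,\gamma)$, $K_\gamma((x,y),\cdot)$ is the law of $(\Pi(\tilde X),\Pi(\tilde Y))$, where $\tilde X=\mathcal T_\gamma(x)+z$, and $\tilde Y=\tilde X$ if $E=0$ or $U\le 1\wedge\frac{\varphi_\gamma(\|E\|-\langle e,z\rangle)}{\varphi_\gamma(\langle e,z\rangle)}$, and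 $\tilde Y=\mathcal T_\gamma(y)+(\mathrm{Id}-2ee^\top)z$ otherwise. Assume: * (B2) there is $L\ge0$ with $\|b(x)-b(y)\|\le L\|x-y\|$ for all $x,y\in X$; * (C2) there are $R_2\ge 0$, $m_2^+>0$ with $\langle b(x),x\rangle\le -m_2^+\|x\|^2$ for all $x\in X$ with $\|x\|>R_2$; * $\bar\gamma>0$ and $\bar\gamma L^2<2m_2^+$; * either (B3($m$)) $m\le 0$ and $\langle b(x)-b(y),x-y\rangle\le -m\|x-y\|^2$ for all $x,y\in X$; or (B4) there is $m_b>0$ with $\bar\gamma\le 2m_b$ and $\langle b(x)-b(y),x-y\rangle\le -m_b\|b(x)-b(y)\|^2$ for all $x,y\in X$; under B4 put $m=0$ below. Set $$\lambda=e^{-(m_2^+-\bar\gamma L^2/2)},\quad A=d+2R_2^2(m_2^+-m)+2m_2^+,\quad R=\sqrt2\,\lambda^{-\bar\gamma}A^{1/2}\log^{-1/2}(1/\lambda),\quad M=2R,$$ $$V(x)=1+\|x\|^2,\quad \mathcal V_2(x,y)=1+\tfrac{\|x\|^2}{2}+\tfrac{\|y\|^2}{2},\quad \mathbf c_2(x,y)=\mathbf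 1_{x\ne y}\mathcal V_2(x,y),\quad C=(\bar B(0,R)\times\bar B(0,R))\cap X^2 .$$ Let $\Phi$ be the standard normal distribution function, $\kappa(\gamma)=-2m+L^2\gamma$, $\Xi_n=\gamma\sum_{k=1}^n(1+\gamma\kappa(\gamma))^{-k}$, and $\Psi_0(\gamma,\ell,t)=2\Phi\big(-t/(2\,\Xi_{\ell\lceil1/\gamma\rceil}^{1/2})\big)$. Under B3($m$) let $\Psi=\Psi_0$. Under B4 fix an arbitrary integer $\ell_0\ge M^2$ and let $\Psi(\gamma,\ell,t)=2\Phi(-1/2)$ if $\ell\ge\ell_0$ and $t\le M$, and $\Psi=\Psi_0$ otherwise. Write $\Delta_X=\{(x,x):x\in X\}$, $\Delta_X^c=X^2\setminus\Delta_X$ and $\Delta_{X,r}=\{(x,y)\in X^2:\|x-y\|\le r\}$. Then $\lambda\in(0,1)$, $A\ge0$, $M>0$, $\mathcal V_2\ge1$ is measurable, $C$ is measurable, $C\subset\Delta_{X,M}$, and the following hold. (i) For every $\gamma\in(0,\bar\gamma]$: $R_\gamma$ and $K_\gamma$ are Markov kernels; $K_\gamma((x,y),\cdot)$ is a coupling of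 $R_\gamma(x,\cdot)$ and $R_\gamma(y,\cdot)$; $K_\gamma\mathcal V_2\le\lambda^\gamma\mathcal V_2+A\gamma\mathbf 1_C$; $K_\gamma((x,x),\Delta_X)=1$; and for every integer $\ell\ge1$, $\Psi(\gamma,\ell,\cdot)$ takes values in $[0,1]$ on $[0,\infty)$, $K_\gamma^{\ell\lceil1/\gamma\rceil}((x,y),\Delta_X^c)\le1-\Psi(\gamma,\ell,\|x-y\|)$ for all $x,y\in X$, and $\inf_{(x,y)\in\Delta_{X,M'}}\Psi(\gamma,\ell,\|x-y\|)>0$ for all $M'\ge0$. (ii) For all $\gamma\in(0,\bar\gamma]$, integers $\ell\ge1$, $k\ge0$ and $x,y\in X$, $$\mathbf W_{\mathbf c_2}(\delta_xR_\gamma^k,\delta_yR_\gamma^k)\le K_\gamma^k\mathbf c_2(x,y)\le\lambda^{k\gamma/4}\big[D_1\mathbf c_2(x,y)+D_2\mathbf 1_{x\ne y}\big]+C_1\rho^{k\gamma/4}\mathbf 1_{x\ne y},$$ where $\mathbf W_{\mathbf c_2}$ is the infimum of $\int\mathbf c_2\,d\zeta$ over couplings $\zeta$, and $$D_1=1+\frac{4A}{\log(1/\lambda)\lambda^{\bar\gamma}},\quad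 D_2=D_1A\lambda^{-(1+\bar\gamma)\ell}(1+\bar\gamma)\ell,\quad C_1=\frac{8A}{\log(1/\rho)\rho^{\bar\gamma}},\quad \log\rho=\frac{\log\lambda\,\log(1-\varepsilon)}{-\log c_1+\log(1-\varepsilon)},$$ $$c_1=B+A\lambda^{-(1+\bar\gamma)\ell}(1+\bar\gamma)\ell,\quad B=\sup_C\mathcal V_2,\quad \varepsilon=\inf_{\gamma\in(0,\bar\gamma],\,(x,y)\in\Delta_{X,M}}\Psi(\gamma,\ell,\|x-y\|).$$ If moreover $\bar\gamma\le1$ and $\varepsilon\le1-e^{-1}$, then $$\frac1{\log(\rho^{-1})}\le\frac{1+\log B+\log(1+2A\ell)+2\ell\log(\lambda^{-1})}{\log(\lambda^{-1})\,\varepsilon}.$$ (iii) For every $\ell\ge1$ one has $\varepsilon>0$, and if $X\ne\{0\}$ then $\varepsilon<1$ and $\lambda\le\rho<1$. For all $\gamma\in(0,\bar\gamma]$, $\ell\ge1$, $k\ge0$ and $x,y\in X$, both $\mathbf W_{\mathbf c_2}(\delta_xR_\gamma^k,\delta_yR_\gamma^k)$ and $\|\delta_xR_\gamma^k-\delta_yR_\gamma^k\|_V$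 are at most $$\rho^{k\gamma/4}\,(D_1+D_2+C_1)\,\mathbf c_2(x,y),$$ where $\|\mu-\nu\|_V=\frac12\sup\{|\mu(f)-\nu(f)|: f \text{ measurable},\ |f|\le V\}$, and $\mathcal V_2(x,y)=(V(x)+V(y))/2$. (If $X=\{0\}$ both sides of all these bounds are $0$, whatever value in $[0,\infty)$ is given to the then undefined constants.) -/

import Mathlib

open MeasureTheory ProbabilityTheory Set
open scoped ENNReal

noncomputable section

/-- The Euclidean space `ℝ^d`. -/
abbrev Eucl (d : ℕ) : Type := EuclideanSpace ℝ (Fin d)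

/-! ### General notions: Wasserstein cost, `V`-norm, couplings -/

/-- The cost `c(x, y) = 1_{x ≠ y} V(x, y)`. -/
def offDiagCost {S : Type*} (V : S × S → ℝ) (p : S × S) : ℝ :=
  (diagonal S)ᶜ.indicator V p

/-- The set of transference plans (couplings) of `μ` and `ν`. -/
def transferencePlans {S : Type*} [MeasurableSpace S] (μ ν : Measure S) :
    Set (Measure (S × S)) :=
  {ζ | ζ.map Prod.fst = μ ∧ ζ.map Prod.snd = ν}

/-- The Wasserstein cost `W_c(μ, ν)` for a nonnegative cost `c`, with values in `[0, ∞]`. -/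
def wassersteinCost {S : Type*} [MeasurableSpace S] (c : S × S → ℝ) (μ ν : Measure S) : ℝ≥0∞ :=
  ⨅ ζ ∈ transferencePlans μ ν, ∫⁻ p, ENNReal.ofReal (c p) ∂ζ

/-- The `V`-total variation norm `‖μ - ν‖_V`, i.e. half the supremum of `|μ(f) - ν(f)|` over
all measurable `f` with `|f| ≤ V`. -/
def vNormDist {S : Type*} [MeasurableSpace S] (V : S → ℝ) (μ ν : Measure S) : ℝ≥0∞ :=
  2⁻¹ * ⨆ (f : S → ℝ) (_ : Measurable f) (_ : ∀ x, |f x| ≤ V x),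
    ENNReal.ofReal |∫ x, f x ∂μ - ∫ x, f x ∂ν|

/-- `K` is a Markov coupling kernel for the Markov kernel `R`. -/
def IsMarkovCoupling {S : Type*} [MeasurableSpace S] (R : Kernel S S)
    (K : Kernel (S × S) (S × S)) : Prop :=
  IsMarkovKernel R ∧ IsMarkovKernel K ∧ ∀ x y : S, K (x, y) ∈ transferencePlans (R x) (R y)

/-- The discrete Foster-Lyapunov drift condition `K V ≤ lam V + A 1_C`. -/
def DriftCondition {S : Type*} [MeasurableSpace S] (K : Kernel S S) (V : S → ℝ)
    (lam A : ℝ) (C : Set S) : Prop :=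
  ∀ p, ∫⁻ q, ENNReal.ofReal (V q) ∂(K p) ≤ ENNReal.ofReal (lam * V p + C.indicator (fun _ ↦ A) p)

/-! ### The projected Euler-Maruyama scheme and its reflection coupling -/

section Scheme

variable {d : ℕ}

/-- The orthogonal projection onto `X`: a point of `X` that minimizes the distance to `u`
(there is exactly one when `X` is non-empty, closed and convex). -/
def projOnto (X : Set (Eucl d)) (hX : X.Nonempty) (u : Eucl d) : X :=
  haveI : Nonempty X := hX.to_subtype
  Classical.epsilon fun p : X ↦ ∀ q : X, ‖(p : Eucl d) - u‖ ≤ ‖(q : Eucl d) - u‖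

/-- The Euler map `T_γ(x) = x + γ b(x)`. -/
def eulerMap (b : Eucl d → Eucl d) (γ : ℝ) (x : Eucl d) : Eucl d := x + γ • b x

/-- The Markov kernel on `X` of the recursion `X_{k+1} = Π(T_γ(X_k) + √γ Z_{k+1})`, where `Z` is
a standard Gaussian vector. -/
def projEulerKernel (X : Set (Eucl d)) (hX : X.Nonempty) (b : Eucl d → Eucl d) (γ : ℝ) :
    Kernel X X :=
  (Kernel.id ×ₖ Kernel.const X (stdGaussian (Eucl d))).map
    fun q : X × Eucl d ↦ projOnto X hX (eulerMap b γ q.1 + √γ • q.2)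

/-- `E(x, y) = T_γ(y) - T_γ(x)`. -/
def eulerDiff (b : Eucl d → Eucl d) (γ : ℝ) (x y : Eucl d) : Eucl d :=
  eulerMap b γ y - eulerMap b γ x

/-- `e(x, y) = E(x, y) / ‖E(x, y)‖`, which is `0` if `E(x, y) = 0`. -/
def eulerDir (b : Eucl d → Eucl d) (γ : ℝ) (x y : Eucl d) : Eucl d :=
  ‖eulerDiff b γ x y‖⁻¹ • eulerDiff b γ x y

/-- `S_γ(x, y, z) = T_γ(y) + (Id - 2 e(x, y) e(x, y)ᵀ) z`. -/
def reflectedMove (b : Eucl d → Eucl d) (γ : ℝ) (x y z : Eucl d) : Eucl d :=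
  eulerMap b γ y + (z - (2 * inner ℝ (eulerDir b γ x y) z) • eulerDir b γ x y)

/-- `p_γ(x, y, z) = 1 ∧ φ_γ(‖E(x, y)‖ - ⟨e(x, y), z⟩) / φ_γ(⟨e(x, y), z⟩)`, where `φ_γ` is the
density of the centred Gaussian law with variance `γ`. -/
def couplingProb (b : Eucl d → Eucl d) (γ : ℝ) (x y z : Eucl d) : ℝ :=
  min 1 (gaussianPDFReal 0 γ.toNNReal (‖eulerDiff b γ x y‖ - inner ℝ (eulerDir b γ x y) z) /
    gaussianPDFReal 0 γ.toNNReal (inner ℝ (eulerDir b γ x y) z))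

open Classical in
/-- One step of the reflection coupling before projection, driven by the Gaussian
vector `z` and the uniform variable `u`. -/
def reflectionStep (b : Eucl d → Eucl d) (γ : ℝ) (x y z : Eucl d) (u : ℝ) : Eucl d × Eucl d :=
  (eulerMap b γ x + √γ • z,
    if eulerMap b γ x = eulerMap b γ y then eulerMap b γ x + √γ • z
    else if u ≤ couplingProb b γ x y (√γ • z) then eulerMap b γ x + √γ • z
    else reflectedMove b γ x y (√γ • z))

/-- The Markov kernel `K_γ` on `X × X` of the projected reflection coupling. -/
def reflectionCouplingKernel (X : Set (Eucl d)) (hX : X.Nonempty) (b : Eucl d → Eucl d)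
    (γ : ℝ) : Kernel (X × X) (X × X) :=
  (Kernel.id ×ₖ Kernel.const (X × X)
      ((stdGaussian (Eucl d)).prod (volume : Measure unitInterval))).map
    fun q : (X × X) × (Eucl d × unitInterval) ↦
      Prod.map (projOnto X hX) (projOnto X hX)
        (reflectionStep b γ q.1.1 q.1.2 q.2.1 q.2.2)

end Scheme

/-! ### Convergence under a drift condition and a minorization condition -/

section Convergence

variable {d : ℕ} {X : Set (Eucl d)}

/-- `Δ_{X, M} = {(x, y) ∈ X² : ‖x - y‖ ≤ M}`. -/
def closePairs (X : Set (Eucl d)) (M : ℝ) : Set (X × X) :=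
  {p | ‖(p.1 : Eucl d) - p.2‖ ≤ M}

/-- The drift and minorization conditions, uniform in the step size `γ ∈ (0, γbar]`, for the
kernels `R γ` and `K γ`. -/
structure DriftMinorization (R : ℝ → Kernel X X) (K : ℝ → Kernel (X × X) (X × X))
    (γbar lam A M : ℝ) (V : X × X → ℝ) (C : Set (X × X)) (Ψ : ℝ → ℕ → ℝ → ℝ) : Prop where
  lam_mem : lam ∈ Ioo (0 : ℝ) 1
  A_nonneg : 0 ≤ A
  M_pos : 0 < M
  measurable_V : Measurable V
  one_le_V : ∀ p, 1 ≤ V p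
  measurableSet_C : MeasurableSet C
  C_subset : C ⊆ closePairs X M
  coupling : ∀ γ ∈ Ioc 0 γbar, IsMarkovCoupling (R γ) (K γ)
  drift : ∀ γ ∈ Ioc 0 γbar, DriftCondition (K γ) V (lam ^ γ) (A * γ) C
  absorbing : ∀ γ ∈ Ioc 0 γbar, ∀ x : X, K γ (x, x) (diagonal X) = 1
  Ψ_mem : ∀ γ ∈ Ioc 0 γbar, ∀ ℓ : ℕ, 1 ≤ ℓ → ∀ t : ℝ, 0 ≤ t → Ψ γ ℓ t ∈ Icc (0 : ℝ) 1
  minorization : ∀ γ ∈ Ioc 0 γbar, ∀ ℓ : ℕ, 1 ≤ ℓ → ∀ x y : X,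
    (K γ ^ (ℓ * ⌈1 / γ⌉₊)) (x, y) (diagonal X)ᶜ
      ≤ ENNReal.ofReal (1 - Ψ γ ℓ ‖(x : Eucl d) - y‖)
  inf_Ψ_pos : ∀ γ ∈ Ioc 0 γbar, ∀ ℓ : ℕ, 1 ≤ ℓ → ∀ M' : ℝ, 0 ≤ M' →
    0 < sInf ((fun p : X × X ↦ Ψ γ ℓ ‖(p.1 : Eucl d) - p.2‖) '' closePairs X M')

/-- `ε = inf {Ψ(γ, ℓ, ‖x - y‖) : γ ∈ (0, γbar], (x, y) ∈ Δ_{X, M}}`. -/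
def minorizationConst (X : Set (Eucl d)) (γbar M : ℝ) (Ψ : ℝ → ℕ → ℝ → ℝ) (ℓ : ℕ) : ℝ :=
  sInf {r | ∃ γ ∈ Ioc 0 γbar, ∃ p ∈ closePairs X M, r = Ψ γ ℓ ‖(p.1 : Eucl d) - p.2‖}

/-- `B = sup_C V`. -/
def supOn (V : X × X → ℝ) (C : Set (X × X)) : ℝ := sSup (V '' C)

/-- `c₁ = B + A lam^{-(1 + γbar) ℓ} (1 + γbar) ℓ`. -/
def constC (γbar lam A B : ℝ) (ℓ : ℕ) : ℝ :=
  B + A * lam ^ (-((1 + γbar) * ℓ)) * (1 + γbar) * ℓ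

/-- The rate `ρ₁`: `log ρ₁ = log(lam) log(1 - ε) / (-log c₁ + log(1 - ε))`. -/
def rateRho (γbar lam A B ε : ℝ) (ℓ : ℕ) : ℝ :=
  Real.exp (Real.log lam * Real.log (1 - ε) /
    (-Real.log (constC γbar lam A B ℓ) + Real.log (1 - ε)))

/-- `D₁ = 1 + 4 A log⁻¹(1/lam) / lam^γbar`. -/
def constD₁ (γbar lam A : ℝ) : ℝ := 1 + 4 * A * (Real.log (1 / lam))⁻¹ / lam ^ γbar

/-- `D₂ = D₁ A lam^{-(1 + γbar) ℓ} (1 + γbar) ℓ`. -/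
def constD₂ (γbar lam A : ℝ) (ℓ : ℕ) : ℝ :=
  constD₁ γbar lam A * A * lam ^ (-((1 + γbar) * ℓ)) * (1 + γbar) * ℓ

/-- `C₁ = 8 A log⁻¹(1/ρ₁) / ρ₁^γbar`. -/
def constC₁ (γbar A ρ : ℝ) : ℝ := 8 * A * (Real.log (1 / ρ))⁻¹ / ρ ^ γbar

/-- The quantitative convergence bounds, with the explicit constants above, for the cost
`c(x, y) = 1_{x ≠ y} V(x, y)`. -/
structure QuantitativeConvergence (R : ℝ → Kernel X X) (K : ℝ → Kernel (X × X) (X × X))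
    (γbar lam A M : ℝ) (V : X × X → ℝ) (C : Set (X × X)) (Ψ : ℝ → ℕ → ℝ → ℝ) : Prop where
  wasserstein_le : ∀ γ ∈ Ioc 0 γbar, ∀ (x y : X) (k : ℕ),
    wassersteinCost (offDiagCost V) ((R γ ^ k) x) ((R γ ^ k) y)
      ≤ ∫⁻ p, ENNReal.ofReal (offDiagCost V p) ∂((K γ ^ k) (x, y))
  coupling_le : ∀ γ ∈ Ioc 0 γbar, ∀ ℓ : ℕ, 1 ≤ ℓ → ∀ (x y : X) (k : ℕ),
    ∫⁻ p, ENNReal.ofReal (offDiagCost V p) ∂((K γ ^ k) (x, y))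
      ≤ ENNReal.ofReal
        (lam ^ (k * γ / 4) * (constD₁ γbar lam A * offDiagCost V (x, y)
            + constD₂ γbar lam A ℓ * (diagonal X)ᶜ.indicator (fun _ ↦ 1) (x, y))
          + constC₁ γbar A (rateRho γbar lam A (supOn V C) (minorizationConst X γbar M Ψ ℓ) ℓ)
            * rateRho γbar lam A (supOn V C) (minorizationConst X γbar M Ψ ℓ) ℓ ^ (k * γ / 4)
            * (diagonal X)ᶜ.indicator (fun _ ↦ 1) (x, y))
  rate_le : γbar ≤ 1 → ∀ ℓ : ℕ, 1 ≤ ℓ →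
    minorizationConst X γbar M Ψ ℓ ≤ 1 - Real.exp (-1) →
    (Real.log (rateRho γbar lam A (supOn V C) (minorizationConst X γbar M Ψ ℓ) ℓ)⁻¹)⁻¹
      ≤ (1 + Real.log (supOn V C) + Real.log (1 + 2 * A * ℓ) + 2 * ℓ * Real.log lam⁻¹)
        / (Real.log lam⁻¹ * minorizationConst X γbar M Ψ ℓ)

/-- Geometric convergence in `W`-norm, uniformly in the step size, with rate `ρ₁` per unit of
time; here the cost is built on `V(x, y) = (W(x) + W(y)) / 2`. When `X` is a single point the
bounds hold with both sides equal to zero, and the rate plays no role. -/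
structure UniformGeometricConvergence (R : ℝ → Kernel X X)
    (γbar lam A M : ℝ) (W : X → ℝ) (C : Set (X × X)) (Ψ : ℝ → ℕ → ℝ → ℝ)
    (V : X × X → ℝ) : Prop where
  const_pos : ∀ ℓ : ℕ, 1 ≤ ℓ → 0 < minorizationConst X γbar M Ψ ℓ
  rate_mem : X.Nontrivial → ∀ ℓ : ℕ, 1 ≤ ℓ →
    minorizationConst X γbar M Ψ ℓ < 1 ∧
    rateRho γbar lam A (supOn V C) (minorizationConst X γbar M Ψ ℓ) ℓ ∈ Ico lam 1
  cost_eq : ∀ x y : X, V (x, y) = (W x + W y) / 2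
  wasserstein_le : ∀ γ ∈ Ioc 0 γbar, ∀ ℓ : ℕ, 1 ≤ ℓ → ∀ (x y : X) (k : ℕ),
    wassersteinCost (offDiagCost V) ((R γ ^ k) x) ((R γ ^ k) y)
      ≤ ENNReal.ofReal
        (rateRho γbar lam A (supOn V C) (minorizationConst X γbar M Ψ ℓ) ℓ ^ (k * γ / 4)
          * (constD₁ γbar lam A + constD₂ γbar lam A ℓ
            + constC₁ γbar A (rateRho γbar lam A (supOn V C) (minorizationConst X γbar M Ψ ℓ) ℓ))
          * offDiagCost V (x, y))
  vNorm_le : ∀ γ ∈ Ioc 0 γbar, ∀ ℓ : ℕ, 1 ≤ ℓ → ∀ (x y : X) (k : ℕ),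
    vNormDist W ((R γ ^ k) x) ((R γ ^ k) y)
      ≤ ENNReal.ofReal
        (rateRho γbar lam A (supOn V C) (minorizationConst X γbar M Ψ ℓ) ℓ ^ (k * γ / 4)
          * (constD₁ γbar lam A + constD₂ γbar lam A ℓ
            + constC₁ γbar A (rateRho γbar lam A (supOn V C) (minorizationConst X γbar M Ψ ℓ) ℓ))
          * offDiagCost V (x, y))

end Convergence

/-! ### The explicit quantities of the radially dissipative case -/

section Explicit

/-- The cumulative distribution function of the standard Gaussian law. -/
def stdNormalCdf (t : ℝ) : ℝ := cdf (gaussianReal 0 1) t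

/-- `κ(γ) = -2 m + L² γ`. -/
def kappa (m L γ : ℝ) : ℝ := -2 * m + L ^ 2 * γ

/-- `Ξ_n(κ) = γ ∑_{k=1}^n (1 + γ κ(γ))^{-k}`. -/
def bigXi (m L γ : ℝ) (n : ℕ) : ℝ :=
  γ * ∑ k ∈ Finset.Icc 1 n, ((1 + γ * kappa m L γ) ^ k)⁻¹

/-- `Ψ(γ, ℓ, t) = 2 Φ(-t / (2 Ξ_{ℓ⌈1/γ⌉}(κ)^{1/2}))`. -/
def psiMonotone (m L γ : ℝ) (ℓ : ℕ) (t : ℝ) : ℝ :=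
  2 * stdNormalCdf (-(t / (2 * √(bigXi m L γ (ℓ * ⌈1 / γ⌉₊)))))

open Classical in
/-- `Ψ(γ, ℓ, t) = 2 Φ(-1/2)` if `ℓ ≥ ℓ₀` and `t ≤ M`, and
`2 Φ(-t / (2 Ξ_{ℓ⌈1/γ⌉}(κ)^{1/2}))` with `κ(γ) = L² γ` otherwise. -/
def psiCoercive (L M : ℝ) (ℓ₀ : ℕ) (γ : ℝ) (ℓ : ℕ) (t : ℝ) : ℝ :=
  if ℓ₀ ≤ ℓ ∧ t ≤ M then 2 * stdNormalCdf (-(1 / 2)) else psiMonotone 0 L γ ℓ t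

/-- `lam = exp(-(m₂ - γbar L² / 2))`. -/
def driftLam (m₂ L γbar : ℝ) : ℝ := Real.exp (-(m₂ - γbar * L ^ 2 / 2))

/-- `A = d + 2 R₂² (m₂ - m) + 2 m₂`. -/
def driftA (d : ℕ) (R₂ m₂ m : ℝ) : ℝ := d + 2 * R₂ ^ 2 * (m₂ - m) + 2 * m₂

/-- `R = √2 lam^{-γbar} A^{1/2} log^{-1/2}(1/lam)`. -/
def driftRadius (lam A γbar : ℝ) : ℝ :=
  √2 * lam ^ (-γbar) * √A * (√(Real.log (1 / lam)))⁻¹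

variable {d : ℕ}

/-- `V(x) = 1 + ‖x‖²`. -/
def quadLyapunov (X : Set (Eucl d)) (x : X) : ℝ := 1 + ‖(x : Eucl d)‖ ^ 2

/-- `V₂(x, y) = 1 + ‖x‖²/2 + ‖y‖²/2`. -/
def quadLyapunovPair (X : Set (Eucl d)) (p : X × X) : ℝ :=
  1 + ‖(p.1 : Eucl d)‖ ^ 2 / 2 + ‖(p.2 : Eucl d)‖ ^ 2 / 2

/-- `(B̄(0, r) × B̄(0, r)) ∩ X²`. -/
def ballPair (X : Set (Eucl d)) (r : ℝ) : Set (X × X) :=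
  {p | ‖(p.1 : Eucl d)‖ ≤ r ∧ ‖(p.2 : Eucl d)‖ ≤ r}

/-- The drift and minorization conditions and the resulting convergence bounds for the projected
Euler-Maruyama kernels and their reflection coupling, with `V₂`, given `lam`, `A` and `Ψ`,
`R = driftRadius lam A γbar`, `M = 2R` and `C = B̄(0, R)²`. -/
def ConvergenceFor (X : Set (Eucl d)) (hX : X.Nonempty) (b : Eucl d → Eucl d)
    (γbar lam A : ℝ) (Ψ : ℝ → ℕ → ℝ → ℝ) : Prop :=
  DriftMinorization (projEulerKernel X hX b) (reflectionCouplingKernel X hX b) γbar lam A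
      (2 * driftRadius lam A γbar) (quadLyapunovPair X) (ballPair X (driftRadius lam A γbar)) Ψ ∧
  QuantitativeConvergence (projEulerKernel X hX b) (reflectionCouplingKernel X hX b) γbar lam A
      (2 * driftRadius lam A γbar) (quadLyapunovPair X) (ballPair X (driftRadius lam A γbar)) Ψ ∧
  UniformGeometricConvergence (projEulerKernel X hX b) γbar lam A
      (2 * driftRadius lam A γbar) (quadLyapunov X) (ballPair X (driftRadius lam A γbar)) Ψ
      (quadLyapunovPair X)

end Explicit

end

/-!
Everything rests on two estimates for the reflection coupling of two copies of the scheme.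

*Drift.* The projection is nonexpansive and fixes the origin, so one step satisfies
`E V(X₁) ≤ 1 + ‖T_γ x‖² + γ d`; dissipativity outside of a ball bounds this by
`lam^{2γ} V(x) + A γ` (`lintegral_quadLyapunov_le`). Half of the contraction absorbs `A γ` outside
of the product of balls of radius `driftRadius` (`sq_rpow_mul_add_le`).

*Minorization.* Along `e`, if the first chain moves by the Gaussian variable `s` from `T_γ x`, the
second one moves from `T_γ y` by `s - ‖E‖` (the chains meet) or by `-s`. The accepted part has
density `min (φ s) (φ (‖E‖ - s))`, which is symmetric under `s ↦ ‖E‖ - s`; this gives the second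
marginal (`lintegral_reflectionStep_snd`). For the distance, let `signMean v t = E sign (t - 2 W)`
with `W` of law `N(0, v)`. It is odd and nondecreasing in `t`, equal to `sign t` for `v = 0` and to
`1 - 2 Φ(-t / (2 √v))` for `v > 0`. Oddness about `s = ‖E‖ / 2` and the convolution of Gaussian laws
show that the mean of `signMean v` at the new distance is at most `signMean (v + γ)` at `‖E‖`
(`lintegral_signMean_le`). As `‖E‖²` is at most `g ‖x - y‖²`, scaling and induction on the number of
steps bound the probability of not having met by `signMean` with variance `γ ∑_{k ≤ n} g⁻ᵏ`
(`pow_reflectionCouplingKernel_compl_le`), which is `Ξ_n` for `g = 1 + γ κ(γ)`, and `γ n` in the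
co-coercive case, where `g = 1`.

*Convergence.* Let `β = lam^γ` and let `c` be the constant `constC`. The exponent `θ` with
`ρ = lam^θ` is such that `(1 - ε)^{1 - θ} c^θ = 1`. By Hölder's inequality the weight `V^θ`
contracts by `β^θ` per step, by the drift outside of `C` and by the minorization on `C`. Hence the
chains have not met at time `j` with probability at most `min 1 ((β^{j - N} V)^θ)`, where
`N = ℓ ⌈1 / γ⌉` (`pow_compl_le_rpow`). Splitting according to whether `β^{j / 2}` times the
prefactor is below `1` separates the two rates (`min_one_rpow_le`); this is where the factor `1 / 4`
in the exponents comes from. Inserting the outcome into `u_{k+1} ≤ β u_k + A γ P(not met at k)`,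
where `u_k` is the mean cost at time `k`, gives the explicit constants
(`lintegral_pow_indicator_compl_le`).
-/

/-! ### Markov kernels with an absorbing set -/

section AbsorbingKernel

variable {T : Type*} [MeasurableSpace T] {K : Kernel T T}

lemma isMarkovKernel_pow [IsMarkovKernel K] (n : ℕ) : IsMarkovKernel (K ^ n) := by
  induction n with
  | zero => rw [pow_zero]; exact inferInstanceAs (IsMarkovKernel Kernel.id)
  | succ n ih => rw [Kernel.pow_add, pow_one]; infer_instance

lemma lintegral_pow_add (m n : ℕ) (p : T) {f : T → ℝ≥0∞} (hf : Measurable f) :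
    ∫⁻ q, f q ∂(K ^ (m + n)) p = ∫⁻ r, ∫⁻ q, f q ∂(K ^ n) r ∂(K ^ m) p := by
  rw [add_comm, Kernel.pow_add, Kernel.lintegral_comp _ _ _ hf]

lemma lintegral_pow_zero (p : T) {f : T → ℝ≥0∞} (hf : Measurable f) :
    ∫⁻ q, f q ∂(K ^ 0) p = f p := by
  rw [pow_zero, show (1 : Kernel T T) = Kernel.id from rfl, Kernel.id_apply, lintegral_dirac' _ hf]

variable {D C : Set T} {V : T → ℝ≥0∞}

lemma pow_compl_eq_zero [IsMarkovKernel K] (hD : MeasurableSet D) (habs : ∀ p ∈ D, K p D = 1)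
    (n : ℕ) {p : T} (hp : p ∈ D) : (K ^ n) p Dᶜ = 0 := by
  induction n with
  | zero =>
    rw [pow_zero, show (1 : Kernel T T) = Kernel.id from rfl, Kernel.id_apply,
      Measure.dirac_apply' _ hD.compl]
    simp [hp]
  | succ n ih =>
    rw [Kernel.pow_succ_apply_eq_lintegral _ _ _ hD.compl]
    have h1 : ∀ᵐ q ∂(K ^ n) p, K q Dᶜ = 0 := by
      have : ∀ᵐ q ∂(K ^ n) p, q ∈ D := by rwa [ae_iff]
      filter_upwards [this] with q hq
      rw [prob_compl_eq_zero_iff hD, habs q hq]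
    rw [lintegral_congr_ae h1, lintegral_zero]

/-- The additive term of the drift accumulates at most linearly. -/
lemma lintegral_pow_le_of_drift [IsMarkovKernel K] (hV : Measurable V) {β a : ℝ≥0∞} (hβ : β ≤ 1)
    (hdrift : ∀ p, ∫⁻ q, V q ∂K p ≤ β * V p + a) (n : ℕ) (p : T) :
    ∫⁻ q, V q ∂(K ^ n) p ≤ β ^ n * V p + n * a := by
  induction n with
  | zero => rw [lintegral_pow_zero p hV]; simp
  | succ n ih =>
    have := isMarkovKernel_pow (K := K) n
    rw [lintegral_pow_add n 1 p hV]
    calc ∫⁻ r, ∫⁻ q, V q ∂(K ^ 1) r ∂(K ^ n) p ≤ ∫⁻ r, (β * V r + a) ∂(K ^ n) p := by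
          refine lintegral_mono fun r ↦ ?_
          rw [pow_one]; exact hdrift r
      _ = β * ∫⁻ r, V r ∂(K ^ n) p + a := by
          rw [lintegral_add_right _ measurable_const, lintegral_const_mul _ hV]; simp
      _ ≤ β * (β ^ n * V p + n * a) + a := by gcongr
      _ = β ^ (n + 1) * V p + (β * (n * a) + a) := by ring
      _ ≤ β ^ (n + 1) * V p + (1 * (n * a) + a) := by gcongr
      _ = β ^ (n + 1) * V p + (n + 1 : ℕ) * a := by push_cast; ring

/-- If the weight `w ≥ 1` contracts by `r` in one step outside of `C`, and if on `C` its part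
outside the absorbing set `D` contracts by `r ^ N` after `N` steps, then the probability of not
being absorbed decays like `r ^ j`. The factor `κ` accounts for the first `N` steps. -/
lemma pow_compl_le_of_weight [IsMarkovKernel K] (hD : MeasurableSet D)
    (habs : ∀ p ∈ D, K p D = 1) {w : T → ℝ≥0∞} (hw : Measurable w) (hw1 : ∀ p, 1 ≤ w p)
    {r κ : ℝ≥0∞} {N : ℕ} (hN : 1 ≤ N) (hκ : ∀ j ≤ N, 1 ≤ r ^ j * κ)
    (hout : ∀ p ∉ C, ∫⁻ q, w q ∂K p ≤ r * w p)
    (hin : ∀ p ∈ C, ∫⁻ q in Dᶜ, w q ∂(K ^ N) p ≤ r ^ N) (j : ℕ) (p : T) :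
    (K ^ j) p Dᶜ ≤ r ^ j * κ * w p := by
  induction j using Nat.strong_induction_on generalizing p with
  | _ j ih =>
    have := fun n ↦ isMarkovKernel_pow (K := K) n
    by_cases hp : p ∈ C
    · rcases lt_or_ge j N with hj | hj
      · calc (K ^ j) p Dᶜ ≤ 1 := prob_le_one
          _ ≤ (r ^ j * κ) * w p := by
            simpa using mul_le_mul' (hκ j hj.le) (hw1 p)
      · obtain ⟨i, rfl⟩ := Nat.exists_eq_add_of_le hj
        -- only the paths that are not absorbed after `N` steps contribute
        have hz : ∀ q ∈ D, (K ^ i) q Dᶜ = 0 := fun q hq ↦ pow_compl_eq_zero hD habs i hq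
        calc (K ^ (N + i)) p Dᶜ = ∫⁻ q, (K ^ i) q Dᶜ ∂(K ^ N) p :=
              Kernel.pow_add_apply_eq_lintegral _ _ _ _ hD.compl
          _ = ∫⁻ q in Dᶜ, (K ^ i) q Dᶜ ∂(K ^ N) p := by
              rw [← lintegral_indicator hD.compl]
              congr 1; ext q
              by_cases hq : q ∈ D <;> simp [hq, hz]
          _ ≤ ∫⁻ q in Dᶜ, r ^ i * κ * w q ∂(K ^ N) p :=
              lintegral_mono fun q ↦ ih i (by omega) q
          _ = r ^ i * κ * ∫⁻ q in Dᶜ, w q ∂(K ^ N) p := lintegral_const_mul _ hw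
          _ ≤ r ^ i * κ * r ^ N := by gcongr; exact hin p hp
          _ = r ^ (N + i) * κ * 1 := by ring
          _ ≤ r ^ (N + i) * κ * w p := by gcongr; exact hw1 p
    · cases j with
      | zero =>
        calc (K ^ 0) p Dᶜ ≤ 1 := prob_le_one
          _ ≤ (r ^ 0 * κ) * w p := by
            simpa using mul_le_mul' (hκ 0 (by omega)) (hw1 p)
      | succ i =>
        calc (K ^ (i + 1)) p Dᶜ = ∫⁻ q, (K ^ i) q Dᶜ ∂(K ^ 1) p := by
              rw [add_comm]; exact Kernel.pow_add_apply_eq_lintegral _ _ _ _ hD.compl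
          _ ≤ ∫⁻ q, r ^ i * κ * w q ∂K p := by
              rw [pow_one]; exact lintegral_mono fun q ↦ ih i (by omega) q
          _ = r ^ i * κ * ∫⁻ q, w q ∂K p := lintegral_const_mul _ hw
          _ ≤ r ^ i * κ * (r * w p) := by gcongr; exact hout p hp
          _ = r ^ (i + 1) * κ * w p := by ring

/-- Interpolating by Hölder between the drift of `V` and the minorization on `C`: the weight
`V ^ θ` contracts as soon as `q ^ (1 - θ) * c ^ θ ≤ 1`. -/
lemma pow_compl_le_rpow [IsMarkovKernel K] (hD : MeasurableSet D)
    (habs : ∀ p ∈ D, K p D = 1) (hV : Measurable V) (hV1 : ∀ p, 1 ≤ V p)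
    {β q c : ℝ≥0∞} (hβ : β ≤ 1) (hβ0 : β ≠ 0) {N : ℕ} (hN : 1 ≤ N) {θ : ℝ} (hθ0 : 0 ≤ θ)
    (hθ1 : θ ≤ 1) (hqc : q ^ (1 - θ) * c ^ θ ≤ 1)
    (hout : ∀ p ∉ C, ∫⁻ q, V q ∂K p ≤ β * V p)
    (hq : ∀ p ∈ C, (K ^ N) p Dᶜ ≤ q)
    (hc : ∀ p ∈ C, ∫⁻ q, V q ∂(K ^ N) p ≤ β ^ N * c) (j : ℕ) (p : T) :
    (K ^ j) p Dᶜ ≤ (β ^ j * (β ^ N)⁻¹ * V p) ^ θ := by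
  have := fun n ↦ isMarkovKernel_pow (K := K) n
  have hβt : β ≠ ⊤ := ne_top_of_le_ne_top ENNReal.one_ne_top hβ
  have hpw (n : ℕ) : (β ^ n) ^ θ = (β ^ θ) ^ n := by
    rw [← ENNReal.rpow_natCast, ← ENNReal.rpow_mul, mul_comm, ENNReal.rpow_mul,
      ENNReal.rpow_natCast]
  have hone {x : ℝ≥0∞} (hx : 1 ≤ x) : 1 ≤ x ^ θ := by simpa using ENNReal.rpow_le_rpow hx hθ0
  have key := pow_compl_le_of_weight (K := K) (C := C) hD habs (w := fun p ↦ V p ^ θ)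
    (hV.pow_const θ) (fun p ↦ hone (hV1 p)) (r := β ^ θ)
    (κ := ((β ^ N)⁻¹) ^ θ) hN ?_ ?_ ?_ j p
  · refine key.trans_eq ?_
    rw [ENNReal.mul_rpow_of_nonneg _ _ hθ0, ENNReal.mul_rpow_of_nonneg _ _ hθ0, hpw]
  · intro i hi
    rw [← hpw, ← ENNReal.mul_rpow_of_nonneg _ _ hθ0]
    refine hone ?_
    calc (1 : ℝ≥0∞) = β ^ N * (β ^ N)⁻¹ :=
          (ENNReal.mul_inv_cancel (pow_ne_zero _ hβ0) (ENNReal.pow_ne_top hβt)).symm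
      _ ≤ β ^ i * (β ^ N)⁻¹ := by gcongr ?_ * _; exact pow_le_pow_right_of_le_one' hβ hi
  · intro p hp
    calc ∫⁻ q, V q ^ θ ∂K p = ∫⁻ q, 1 ^ (1 - θ) * V q ^ θ ∂K p := by simp
      _ ≤ (∫⁻ _, 1 ∂K p) ^ (1 - θ) * (∫⁻ q, V q ∂K p) ^ θ :=
          ENNReal.lintegral_mul_norm_pow_le aemeasurable_const hV.aemeasurable (by linarith) hθ0
            (by ring)
      _ ≤ (β * V p) ^ θ := by
          simp only [lintegral_const, measure_univ, mul_one, ENNReal.one_rpow, one_mul]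
          exact ENNReal.rpow_le_rpow (hout p hp) hθ0
      _ = β ^ θ * V p ^ θ := ENNReal.mul_rpow_of_nonneg _ _ hθ0
  · intro p hp
    calc ∫⁻ q in Dᶜ, V q ^ θ ∂(K ^ N) p
        = ∫⁻ q in Dᶜ, 1 ^ (1 - θ) * V q ^ θ ∂(K ^ N) p := by simp
      _ ≤ (∫⁻ _ in Dᶜ, 1 ∂(K ^ N) p) ^ (1 - θ) * (∫⁻ q in Dᶜ, V q ∂(K ^ N) p) ^ θ :=
          ENNReal.lintegral_mul_norm_pow_le aemeasurable_const hV.aemeasurable (by linarith) hθ0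
            (by ring)
      _ ≤ q ^ (1 - θ) * (β ^ N * c) ^ θ := by
          gcongr
          · simpa using hq p hp
          · exact (setLIntegral_le_lintegral _ _).trans (hc p hp)
      _ = (q ^ (1 - θ) * c ^ θ) * (β ^ θ) ^ N := by
          rw [ENNReal.mul_rpow_of_nonneg _ _ hθ0, hpw]; ring
      _ ≤ (β ^ θ) ^ N := by simpa using mul_le_mul_left hqc ((β ^ θ) ^ N)

/-- One-step recursion for the integral of `V` outside the absorbing set. -/
lemma lintegral_pow_succ_indicator_le [IsMarkovKernel K] (hD : MeasurableSet D)
    (habs : ∀ p ∈ D, K p D = 1) (hV : Measurable V) {β a : ℝ≥0∞}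
    (hdrift : ∀ p, ∫⁻ q, V q ∂K p ≤ β * V p + a) (k : ℕ) (p : T) :
    ∫⁻ q, Dᶜ.indicator V q ∂(K ^ (k + 1)) p
      ≤ β * ∫⁻ q, Dᶜ.indicator V q ∂(K ^ k) p + a * (K ^ k) p Dᶜ := by
  have hVD : Measurable (Dᶜ.indicator V) := hV.indicator hD.compl
  rw [lintegral_pow_add k 1 p hVD]
  calc ∫⁻ r, ∫⁻ q, Dᶜ.indicator V q ∂(K ^ 1) r ∂(K ^ k) p
      ≤ ∫⁻ r, (β * Dᶜ.indicator V r + a * Dᶜ.indicator 1 r) ∂(K ^ k) p := by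
        refine lintegral_mono fun r ↦ ?_
        dsimp only
        rw [pow_one]
        by_cases hr : r ∈ D
        · have h0 : K r Dᶜ = 0 := by rw [prob_compl_eq_zero_iff hD, habs r hr]
          rw [lintegral_indicator hD.compl, Measure.restrict_eq_zero.2 h0]
          simp
        · refine (lintegral_mono (indicator_le_self _ _)).trans ?_
          simpa [hr] using hdrift r
    _ = β * ∫⁻ q, Dᶜ.indicator V q ∂(K ^ k) p + a * (K ^ k) p Dᶜ := by
        rw [lintegral_add_left (hVD.const_mul _), lintegral_const_mul _ hVD,
          lintegral_const_mul _ (measurable_one.indicator hD.compl),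
          lintegral_indicator_one hD.compl]

end AbsorbingKernel

/-! ### Explicit constants in the geometric bound -/

section Constants

lemma mul_log_inv_mul_rpow_le {μ s : ℝ} (hμ : 0 < μ) :
    s * Real.log (1 / μ) * μ ^ s ≤ 1 - μ ^ s := by
  have h1 := Real.add_one_le_exp (-(Real.log μ * s))
  have h2 : 0 < μ ^ s := Real.rpow_pos_of_pos hμ s
  have h3 : Real.exp (-(Real.log μ * s)) * μ ^ s = 1 := by
    rw [Real.rpow_def_of_pos hμ, ← Real.exp_add]; simp
  rw [one_div, Real.log_inv]
  nlinarith

/-- The quantitative gap between `μ ^ (γ / 4)` and `lam ^ γ`, for a rate `μ ≥ lam`: it leaves room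
for a perturbation of size `γ` in a recursion with contraction factor `lam ^ γ`. -/
lemma step_le_gap {lam μ γ γbar : ℝ} (hl : 0 < lam) (hlμ : lam ≤ μ) (hμ : μ < 1) (hγ : 0 < γ)
    (hγb : γ ≤ γbar) :
    γ ≤ (μ ^ (γ / 4) - lam ^ γ) * (4 * (Real.log (1 / μ))⁻¹ / μ ^ γbar) := by
  have hμ0 : 0 < μ := hl.trans_le hlμ
  have hlog : 0 < Real.log (1 / μ) := Real.log_pos (by rw [lt_div_iff₀ hμ0]; linarith)
  have hb : 0 < μ ^ γbar := Real.rpow_pos_of_pos hμ0 _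
  have hh : 0 < μ ^ (γ / 4) := Real.rpow_pos_of_pos hμ0 _
  have hh1 : μ ^ (γ / 4) ≤ 1 := Real.rpow_le_one hμ0.le hμ.le (by positivity)
  have h1 := mul_log_inv_mul_rpow_le (s := γ / 4) hμ0
  have h2 : lam ^ γ ≤ (μ ^ (γ / 4)) ^ 2 := by
    calc lam ^ γ ≤ μ ^ γ := Real.rpow_le_rpow hl.le hlμ hγ.le
      _ ≤ μ ^ (γ / 4 * 2) := Real.rpow_le_rpow_of_exponent_ge hμ0 hμ.le (by linarith)
      _ = (μ ^ (γ / 4)) ^ 2 := by rw [Real.rpow_mul hμ0.le]; norm_cast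
  have h3 : μ ^ γbar ≤ (μ ^ (γ / 4)) ^ 2 := by
    calc μ ^ γbar ≤ μ ^ (γ / 4 * 2) := Real.rpow_le_rpow_of_exponent_ge hμ0 hμ.le (by linarith)
      _ = (μ ^ (γ / 4)) ^ 2 := by rw [Real.rpow_mul hμ0.le]; norm_cast
  set h := μ ^ (γ / 4)
  have h4 : γ * (Real.log (1 / μ) * μ ^ γbar) ≤ (h - lam ^ γ) * 4 := by
    calc γ * (Real.log (1 / μ) * μ ^ γbar) ≤ γ * (Real.log (1 / μ) * h ^ 2) := by gcongr
      _ = 4 * (h * (γ / 4 * Real.log (1 / μ) * h)) := by ring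
      _ ≤ 4 * (h * (1 - h)) := by gcongr
      _ ≤ (h - lam ^ γ) * 4 := by nlinarith
  calc γ = γ * (Real.log (1 / μ) * μ ^ γbar) / (Real.log (1 / μ) * μ ^ γbar) := by
        rw [mul_div_cancel_right₀ _ (by positivity)]
    _ ≤ (h - lam ^ γ) * 4 / (Real.log (1 / μ) * μ ^ γbar) := by gcongr
    _ = _ := by field_simp

/-- Separating the two scales in `min 1 ((β ^ t * x * v) ^ θ)`: either `β ^ (t / 2) * x * v ≤ 1`, or
the trivial bound `1` is dominated by the square root of that quantity. -/
lemma min_one_rpow_le {lam x v θ t : ℝ} (hl : 0 < lam) (hl1 : lam ≤ 1) (hx : 0 ≤ x) (hv : 0 ≤ v)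
    (hθ : 0 ≤ θ) (ht : 0 ≤ t) :
    min 1 ((lam ^ t * x * v) ^ θ) ≤ (lam ^ θ) ^ (t / 4) + lam ^ (t / 4) * ((v + x) / 2) := by
  have e1 : lam ^ t = lam ^ (t / 2) * lam ^ (t / 2) := by
    rw [← Real.rpow_add hl]; ring_nf
  have e2 : lam ^ (t / 2) = lam ^ (t / 4) * lam ^ (t / 4) := by
    rw [← Real.rpow_add hl]; ring_nf
  have h2 : 0 < lam ^ (t / 2) := Real.rpow_pos_of_pos hl _
  have h4 : 0 < lam ^ (t / 4) := Real.rpow_pos_of_pos hl _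
  rcases le_total (lam ^ (t / 2) * x * v) 1 with h | h
  · refine (min_le_right _ _).trans ?_
    have : (lam ^ t * x * v) ^ θ ≤ (lam ^ θ) ^ (t / 4) := by
      calc (lam ^ t * x * v) ^ θ ≤ (lam ^ (t / 4)) ^ θ := by
            refine Real.rpow_le_rpow (by positivity) ?_ hθ
            have h5 : lam ^ (t / 2) ≤ lam ^ (t / 4) :=
              Real.rpow_le_rpow_of_exponent_ge hl hl1 (by linarith)
            rw [e1]
            nlinarith
        _ = (lam ^ θ) ^ (t / 4) := by rw [← Real.rpow_mul hl.le, ← Real.rpow_mul hl.le, mul_comm]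
    nlinarith [mul_nonneg h4.le (add_nonneg hv hx)]
  · refine (min_le_left _ _).trans ?_
    have h6 : 1 ≤ lam ^ (t / 4) * ((v + x) / 2) := by
      have : 1 ≤ (lam ^ (t / 4) * ((v + x) / 2)) ^ 2 := by
        rw [e2] at h
        nlinarith [mul_nonneg (mul_nonneg h4.le h4.le) (sq_nonneg (v - x))]
      nlinarith [mul_nonneg h4.le (add_nonneg hv hx)]
    have : 0 ≤ (lam ^ θ) ^ (t / 4) := by positivity
    linarith

end Constants

section Rate

variable {γbar lam A B ε : ℝ} {ℓ : ℕ}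

/-- The exponent `θ` with `ρ = lam ^ θ`, chosen so that `(1 - ε) ^ (1 - θ) * c ^ θ = 1`. -/
noncomputable def rateExponent (c ε : ℝ) : ℝ :=
  Real.log (1 - ε) / (-Real.log c + Real.log (1 - ε))

lemma rateExponent_mem {c ε : ℝ} (hc : 1 ≤ c) (hε0 : 0 < ε) (hε1 : ε < 1) :
    rateExponent c ε ∈ Ioc (0 : ℝ) 1 := by
  have h1 : Real.log (1 - ε) < 0 := Real.log_neg (by linarith) (by linarith)
  have h2 : 0 ≤ Real.log c := Real.log_nonneg hc
  refine ⟨div_pos_of_neg_of_neg h1 (by linarith), ?_⟩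
  rw [rateExponent, div_le_one_of_neg (by linarith)]
  linarith

lemma rpow_rateExponent {c ε : ℝ} (hc : 1 ≤ c) (hε0 : 0 < ε) (hε1 : ε < 1) :
    (1 - ε) ^ (1 - rateExponent c ε) * c ^ rateExponent c ε = 1 := by
  have h1 : Real.log (1 - ε) < 0 := Real.log_neg (by linarith) (by linarith)
  have h2 : 0 ≤ Real.log c := Real.log_nonneg hc
  have h3 : -Real.log c + Real.log (1 - ε) ≠ 0 := by linarith
  rw [Real.rpow_def_of_pos (by linarith), Real.rpow_def_of_pos (by linarith), ← Real.exp_add,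
    Real.exp_eq_one_iff, rateExponent]
  field_simp
  ring

lemma rateRho_eq_rpow (hl : 0 < lam) :
    rateRho γbar lam A B ε ℓ = lam ^ rateExponent (constC γbar lam A B ℓ) ε := by
  rw [rateRho, Real.rpow_def_of_pos hl, rateExponent, mul_div_assoc]

lemma one_le_constC (hl : 0 < lam) (hA : 0 ≤ A) (hB : 1 ≤ B) (hγ : 0 ≤ γbar) :
    1 ≤ constC γbar lam A B ℓ := by
  have : 0 ≤ A * lam ^ (-((1 + γbar) * ℓ)) * (1 + γbar) * ℓ := by positivity
  rw [constC]; linarith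

lemma rateRho_mem (hl : 0 < lam) (hl1 : lam < 1) (hA : 0 ≤ A) (hB : 1 ≤ B) (hγ : 0 ≤ γbar)
    (hε0 : 0 < ε) (hε1 : ε < 1) : rateRho γbar lam A B ε ℓ ∈ Ico lam 1 := by
  have h := rateExponent_mem (one_le_constC (ℓ := ℓ) hl hA hB hγ) hε0 hε1
  rw [rateRho_eq_rpow hl]
  refine ⟨?_, Real.rpow_lt_one hl.le hl1 h.1⟩
  simpa using Real.rpow_le_rpow_of_exponent_ge hl hl1.le h.2

lemma inv_log_inv_rateRho_le (hl : 0 < lam) (hl1 : lam < 1) (hA : 0 ≤ A) (hB : 1 ≤ B)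
    (hγ : 0 ≤ γbar) (hγ1 : γbar ≤ 1) (hε0 : 0 < ε) (hε1 : ε < 1) :
    (Real.log (rateRho γbar lam A B ε ℓ)⁻¹)⁻¹
      ≤ (1 + Real.log B + Real.log (1 + 2 * A * ℓ) + 2 * ℓ * Real.log lam⁻¹)
        / (Real.log lam⁻¹ * ε) := by
  have hc := one_le_constC (ℓ := ℓ) hl hA hB hγ
  have hlogc := Real.log_nonneg hc
  have h1 : Real.log (1 - ε) ≤ -ε := by
    linarith [Real.log_le_sub_one_of_pos (x := 1 - ε) (by linarith)]
  have hlam : 0 < Real.log lam⁻¹ := Real.log_pos ((one_lt_inv₀ hl).2 hl1)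
  have hlc : Real.log (constC γbar lam A B ℓ)
      ≤ Real.log B + Real.log (1 + 2 * A * ℓ) + 2 * ℓ * Real.log lam⁻¹ := by
    have hp : 0 < lam ^ (-(2 * ℓ : ℝ)) := Real.rpow_pos_of_pos hl _
    have hp1 : 1 ≤ lam ^ (-(2 * ℓ : ℝ)) :=
      Real.one_le_rpow_of_pos_of_le_one_of_nonpos hl hl1.le
        (by have := Nat.cast_nonneg (α := ℝ) ℓ; linarith)
    have hle : constC γbar lam A B ℓ ≤ B * (1 + 2 * A * ℓ) * lam ^ (-(2 * ℓ : ℝ)) := by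
      have h5 : lam ^ (-((1 + γbar) * ℓ)) ≤ lam ^ (-(2 * ℓ : ℝ)) := by
        refine Real.rpow_le_rpow_of_exponent_ge hl hl1.le (neg_le_neg ?_)
        gcongr; linarith
      have h6 : A * lam ^ (-((1 + γbar) * ℓ)) * (1 + γbar) * ℓ
          ≤ A * lam ^ (-(2 * ℓ : ℝ)) * 2 * ℓ := by
        gcongr; linarith
      have h7 : 0 ≤ A * ℓ * lam ^ (-(2 * ℓ : ℝ)) := by positivity
      rw [constC]
      nlinarith
    calc Real.log (constC γbar lam A B ℓ)
        ≤ Real.log (B * (1 + 2 * A * ℓ) * lam ^ (-(2 * ℓ : ℝ))) :=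
          Real.log_le_log (by linarith) hle
      _ = _ := by
          rw [Real.log_mul (by positivity) hp.ne', Real.log_mul (by positivity) (by positivity),
            Real.log_rpow hl, Real.log_inv]
          ring
  have hrho : Real.log (rateRho γbar lam A B ε ℓ)⁻¹
      = Real.log lam⁻¹ * rateExponent (constC γbar lam A B ℓ) ε := by
    rw [rateRho_eq_rpow hl, Real.log_inv, Real.log_rpow hl, Real.log_inv]; ring
  have hinv : (Real.log (rateRho γbar lam A B ε ℓ)⁻¹)⁻¹
      = (Real.log (constC γbar lam A B ℓ) / (-Real.log (1 - ε)) + 1) / Real.log lam⁻¹ := by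
    have : Real.log (1 - ε) ≠ 0 := by linarith
    have : -Real.log (constC γbar lam A B ℓ) + Real.log (1 - ε) ≠ 0 := by linarith
    rw [hrho, rateExponent]
    field_simp
  have h8 : Real.log (constC γbar lam A B ℓ) / (-Real.log (1 - ε))
      ≤ Real.log (constC γbar lam A B ℓ) / ε := by gcongr; linarith
  rw [hinv, mul_comm (Real.log lam⁻¹) ε, ← div_div]
  gcongr
  refine (add_le_add_left h8 1).trans ?_
  rw [← sub_nonneg]
  have : 1 ≤ 1 / ε := by rw [le_div_iff₀ hε0]; linarith
  calc (0 : ℝ) ≤ (Real.log B + Real.log (1 + 2 * A * ℓ) + 2 * ℓ * Real.log lam⁻¹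
          - Real.log (constC γbar lam A B ℓ)) / ε + (1 / ε - 1) :=
        add_nonneg (div_nonneg (by linarith) hε0.le) (by linarith)
    _ = _ := by field_simp; ring

end Rate

section GeometricBound

variable {T : Type*} [MeasurableSpace T] {K : Kernel T T} {D C : Set T} {V : T → ℝ}
  {lam A B γ γbar ε : ℝ} {N ℓ : ℕ}

/-- Decay of the probability of not being absorbed, with the two rates separated. -/
lemma pow_compl_le_of_drift [IsMarkovKernel K] (hD : MeasurableSet D)
    (habs : ∀ p ∈ D, K p D = 1) (hV : Measurable V) (hV1 : ∀ p, 1 ≤ V p)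
    (hl : 0 < lam) (hl1 : lam < 1) (hA : 1 ≤ A) (hγ : 0 < γ) (hγb : γ ≤ γbar) (hℓ : 1 ≤ ℓ)
    (hN : 1 ≤ N) (hNγ : γ * N ≤ (1 + γbar) * ℓ) (hB1 : 1 ≤ B) (hB : ∀ p ∈ C, V p ≤ B)
    (hε0 : 0 < ε) (hε1 : ε < 1)
    (hdrift : ∀ p, ∫⁻ q, ENNReal.ofReal (V q) ∂K p
      ≤ ENNReal.ofReal (lam ^ γ * V p + C.indicator (fun _ ↦ A * γ) p))
    (hmin : ∀ p ∈ C, (K ^ N) p Dᶜ ≤ ENNReal.ofReal (1 - ε)) (k : ℕ) (p : T) :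
    (K ^ k) p Dᶜ ≤ ENNReal.ofReal (rateRho γbar lam A B ε ℓ ^ (k * γ / 4) +
      lam ^ (k * γ / 4) *
        ((V p + A * lam ^ (-((1 + γbar) * ℓ)) * (1 + γbar) * ℓ) / 2)) := by
  have hMk := fun n ↦ isMarkovKernel_pow (K := K) n
  have hγb0 : 0 ≤ γbar := by linarith
  set X' := A * lam ^ (-((1 + γbar) * ℓ)) * (1 + γbar) * ℓ with hX'
  set c := constC γbar lam A B ℓ with hc
  have hcX : c = B + X' := rfl
  have hc1 : 1 ≤ c := one_le_constC hl (by linarith) hB1 hγb0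
  have hθ := rateExponent_mem hc1 hε0 hε1
  set θ := rateExponent c ε with hθdef
  have hβ0 : 0 < lam ^ γ := Real.rpow_pos_of_pos hl _
  have hβ1 : lam ^ γ ≤ 1 := Real.rpow_le_one hl.le hl1.le hγ.le
  have hpow (n : ℕ) : (lam ^ γ) ^ n = lam ^ (n * γ) := by
    rw [mul_comm, Real.rpow_mul hl.le, Real.rpow_natCast]
  have hX'0 : 0 ≤ X' := by positivity
  have hℓ1 : 1 ≤ (1 + γbar) * ℓ := by
    have : (1 : ℝ) ≤ ℓ := by exact_mod_cast hℓ
    nlinarith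
  have hpN : 1 ≤ lam ^ (N * γ) * lam ^ (-((1 + γbar) * ℓ)) := by
    rw [← Real.rpow_add hl]
    exact Real.one_le_rpow_of_pos_of_le_one_of_nonpos hl hl1.le (by linarith)
  have hinvX : (lam ^ (N * γ))⁻¹ ≤ X' := by
    have h1 : (lam ^ (N * γ))⁻¹ ≤ lam ^ (-((1 + γbar) * ℓ)) := by
      rw [inv_le_iff_one_le_mul₀' (Real.rpow_pos_of_pos hl _)]
      exact hpN
    have h2 : 0 < lam ^ (-((1 + γbar) * ℓ)) := Real.rpow_pos_of_pos hl _
    calc (lam ^ (N * γ))⁻¹ ≤ 1 * lam ^ (-((1 + γbar) * ℓ)) * 1 := by simpa using h1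
      _ ≤ A * lam ^ (-((1 + γbar) * ℓ)) * ((1 + γbar) * ℓ) := by gcongr
      _ = X' := by rw [hX']; ring
  have hVm : Measurable fun p ↦ ENNReal.ofReal (V p) := hV.ennreal_ofReal
  have hdrift' (p : T) : ∫⁻ q, ENNReal.ofReal (V q) ∂K p
      ≤ ENNReal.ofReal (lam ^ γ) * ENNReal.ofReal (V p) + ENNReal.ofReal (A * γ) := by
    have := hV1 p
    refine (hdrift p).trans ?_
    rw [← ENNReal.ofReal_mul hβ0.le, ← ENNReal.ofReal_add (by positivity) (by positivity)]
    refine ENNReal.ofReal_le_ofReal ?_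
    gcongr
    exact indicator_le_self' (fun _ _ ↦ by positivity) _
  have key := pow_compl_le_rpow (K := K) (C := C) hD habs hVm
    (fun p ↦ ENNReal.one_le_ofReal.2 (hV1 p)) (β := ENNReal.ofReal (lam ^ γ))
    (q := ENNReal.ofReal (1 - ε)) (c := ENNReal.ofReal c) (ENNReal.ofReal_le_one.2 hβ1)
    (by simpa using hβ0) hN hθ.1.le hθ.2 ?_ ?_ hmin ?_ k p
  · have hVp := hV1 p
    calc (K ^ k) p Dᶜ ≤ min 1 (ENNReal.ofReal ((lam ^ (k * γ) * X' * V p) ^ θ)) := by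
          refine le_min prob_le_one (key.trans ?_)
          rw [← ENNReal.ofReal_rpow_of_nonneg (by positivity) hθ.1.le]
          refine ENNReal.rpow_le_rpow ?_ hθ.1.le
          rw [ENNReal.ofReal_mul (by positivity), ENNReal.ofReal_mul (by positivity),
            ← ENNReal.ofReal_pow hβ0.le, ← ENNReal.ofReal_pow hβ0.le, hpow, hpow,
            ← ENNReal.ofReal_inv_of_pos (Real.rpow_pos_of_pos hl _)]
          gcongr
      _ = ENNReal.ofReal (min 1 ((lam ^ (k * γ) * X' * V p) ^ θ)) := by
          rw [ENNReal.ofReal_min]; simp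
      _ ≤ _ := by
          refine ENNReal.ofReal_le_ofReal ?_
          rw [rateRho_eq_rpow hl]
          exact min_one_rpow_le hl hl1.le hX'0 (by linarith) hθ.1.le (by positivity)
  · rw [ENNReal.ofReal_rpow_of_pos (by linarith), ENNReal.ofReal_rpow_of_pos (by linarith),
      ← ENNReal.ofReal_mul (Real.rpow_nonneg (by linarith) _),
      rpow_rateExponent hc1 hε0 hε1, ENNReal.ofReal_one]
  · intro p hp
    refine (hdrift p).trans_eq ?_
    rw [← ENNReal.ofReal_mul hβ0.le]
    simp [hp]
  · intro p hp
    have hVp := hV1 p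
    refine (lintegral_pow_le_of_drift hVm (ENNReal.ofReal_le_one.2 hβ1) hdrift' N p).trans ?_
    rw [← ENNReal.ofReal_pow hβ0.le, ← ENNReal.ofReal_mul (by positivity),
      ← ENNReal.ofReal_natCast, ← ENNReal.ofReal_mul (by positivity),
      ← ENNReal.ofReal_add (by positivity) (by positivity), ← ENNReal.ofReal_mul (by positivity),
      hpow]
    refine ENNReal.ofReal_le_ofReal ?_
    rw [hcX, mul_add]
    refine add_le_add (by gcongr; exact hB p hp) ?_
    · calc N * (A * γ) = 1 * (A * (γ * N)) := by ring
        _ ≤ (lam ^ (N * γ) * lam ^ (-((1 + γbar) * ℓ))) * (A * ((1 + γbar) * ℓ)) := by gcongr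
        _ = lam ^ (N * γ) * X' := by rw [hX']; ring

/-- Geometric decay of the `V`-weighted mass outside the absorbing set. -/
theorem lintegral_pow_indicator_compl_le [IsMarkovKernel K] (hD : MeasurableSet D)
    (habs : ∀ p ∈ D, K p D = 1) (hV : Measurable V) (hV1 : ∀ p, 1 ≤ V p)
    (hl : 0 < lam) (hl1 : lam < 1) (hA : 1 ≤ A) (hγ : 0 < γ) (hγb : γ ≤ γbar) (hℓ : 1 ≤ ℓ)
    (hN : 1 ≤ N) (hNγ : γ * N ≤ (1 + γbar) * ℓ) (hB1 : 1 ≤ B) (hB : ∀ p ∈ C, V p ≤ B)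
    (hε0 : 0 < ε) (hε1 : ε < 1)
    (hdrift : ∀ p, ∫⁻ q, ENNReal.ofReal (V q) ∂K p
      ≤ ENNReal.ofReal (lam ^ γ * V p + C.indicator (fun _ ↦ A * γ) p))
    (hmin : ∀ p ∈ C, (K ^ N) p Dᶜ ≤ ENNReal.ofReal (1 - ε)) (k : ℕ) {p : T} (hp : p ∉ D) :
    ∫⁻ q, ENNReal.ofReal (Dᶜ.indicator V q) ∂(K ^ k) p
      ≤ ENNReal.ofReal (lam ^ (k * γ / 4) * (constD₁ γbar lam A * V p + constD₂ γbar lam A ℓ)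
          + constC₁ γbar A (rateRho γbar lam A B ε ℓ) *
            rateRho γbar lam A B ε ℓ ^ (k * γ / 4)) := by
  have hγb0 : 0 ≤ γbar := by linarith
  have hρ := rateRho_mem (ℓ := ℓ) hl hl1 (by linarith : 0 ≤ A) hB1 hγb0 hε0 hε1
  set ρ := rateRho γbar lam A B ε ℓ with hρdef
  have hρ0 : 0 < ρ := hl.trans_le hρ.1
  have hβ0 : 0 < lam ^ γ := Real.rpow_pos_of_pos hl _
  have hVp := hV1 p
  have hind (q : T) : ENNReal.ofReal (Dᶜ.indicator V q)
      = Dᶜ.indicator (fun q ↦ ENNReal.ofReal (V q)) q := by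
    by_cases hq : q ∈ D <;> simp [hq]
  simp_rw [hind]
  have hVm : Measurable fun p ↦ ENNReal.ofReal (V p) := hV.ennreal_ofReal
  have hdrift' (p : T) : ∫⁻ q, ENNReal.ofReal (V q) ∂K p
      ≤ ENNReal.ofReal (lam ^ γ) * ENNReal.ofReal (V p) + ENNReal.ofReal (A * γ) := by
    have := hV1 p
    refine (hdrift p).trans ?_
    rw [← ENNReal.ofReal_mul hβ0.le, ← ENNReal.ofReal_add (by positivity) (by positivity)]
    refine ENNReal.ofReal_le_ofReal ?_
    gcongr
    exact indicator_le_self' (fun _ _ ↦ by positivity) _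
  set X' := A * lam ^ (-((1 + γbar) * ℓ)) * (1 + γbar) * ℓ with hX'
  have hX'0 : 0 ≤ X' := by positivity
  have hD2 : constD₁ γbar lam A * V p + constD₂ γbar lam A ℓ = constD₁ γbar lam A * (V p + X') := by
    rw [constD₂, hX']; ring
  rw [hD2]
  have hlogl : 0 < Real.log (1 / lam) := Real.log_pos (by rw [lt_div_iff₀ hl]; linarith)
  have hlogρ : 0 < Real.log (1 / ρ) := Real.log_pos (by rw [lt_div_iff₀ hρ0]; linarith [hρ.2])
  have hgl := step_le_gap hl le_rfl hl1 hγ hγb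
  have hgρ := step_le_gap hl hρ.1 hρ.2 hγ hγb
  have hD1 : constD₁ γbar lam A = 1 + A * (4 * (Real.log (1 / lam))⁻¹ / lam ^ γbar) := by
    rw [constD₁]; ring
  have hC1 : constC₁ γbar A ρ = 2 * (A * (4 * (Real.log (1 / ρ))⁻¹ / ρ ^ γbar)) := by
    rw [constC₁]; ring
  have hal : 0 ≤ 4 * (Real.log (1 / lam))⁻¹ / lam ^ γbar := by positivity
  have haρ : 0 ≤ 4 * (Real.log (1 / ρ))⁻¹ / ρ ^ γbar := by positivity
  -- each gap `step_le_gap` pays for one of the two terms of `pow_compl_le_of_drift`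
  set al := 4 * (Real.log (1 / lam))⁻¹ / lam ^ γbar
  set aρ := 4 * (Real.log (1 / ρ))⁻¹ / ρ ^ γbar
  rw [hD1, hC1]
  induction k with
  | zero =>
    rw [lintegral_pow_zero p (hVm.indicator hD.compl)]
    have : p ∈ Dᶜ := hp
    simp only [indicator_of_mem this]
    refine ENNReal.ofReal_le_ofReal ?_
    have h1 : 0 ≤ A * al := by positivity
    have h2 : 0 ≤ 2 * (A * aρ) := by positivity
    simp only [Nat.cast_zero, zero_mul, zero_div, Real.rpow_zero, one_mul, mul_one]
    nlinarith
  | succ k ih =>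
    refine (lintegral_pow_succ_indicator_le hD habs hVm hdrift' k p).trans ?_
    have hak := pow_compl_le_of_drift hD habs hV hV1 hl hl1 hA hγ hγb hℓ hN hNγ hB1 hB hε0 hε1
      hdrift hmin k p
    rw [← hρdef, ← hX'] at hak
    set g := lam ^ (k * γ / 4) with hg
    set h := ρ ^ (k * γ / 4) with hh
    have hg0 : 0 < g := Real.rpow_pos_of_pos hl _
    have hh0 : 0 < h := Real.rpow_pos_of_pos hρ0 _
    have hgs : lam ^ ((k + 1 : ℕ) * γ / 4) = g * lam ^ (γ / 4) := by
      rw [hg, ← Real.rpow_add hl]; congr 1; push_cast; ring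
    have hhs : ρ ^ ((k + 1 : ℕ) * γ / 4) = h * ρ ^ (γ / 4) := by
      rw [hh, ← Real.rpow_add hρ0]; congr 1; push_cast; ring
    calc _ ≤ ENNReal.ofReal (lam ^ γ) *
            ENNReal.ofReal (g * ((1 + A * al) * (V p + X')) + 2 * (A * aρ) * h)
          + ENNReal.ofReal (A * γ) * ENNReal.ofReal (h + g * ((V p + X') / 2)) := by gcongr
      _ = ENNReal.ofReal (lam ^ γ * (g * ((1 + A * al) * (V p + X')) + 2 * (A * aρ) * h)
          + A * γ * (h + g * ((V p + X') / 2))) := by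
          rw [← ENNReal.ofReal_mul hβ0.le, ← ENNReal.ofReal_mul (by positivity),
            ← ENNReal.ofReal_add (by positivity) (by positivity)]
      _ ≤ _ := by
          refine ENNReal.ofReal_le_ofReal ?_
          rw [hgs, hhs]
          have h1 : lam ^ γ ≤ lam ^ (γ / 4) :=
            Real.rpow_le_rpow_of_exponent_ge hl hl1.le (by linarith)
          have h2 : A * γ * h ≤ A * ((ρ ^ (γ / 4) - lam ^ γ) * aρ) * h := by gcongr
          have h3 : A * γ * (g * (V p + X')) ≤ A * ((lam ^ (γ / 4) - lam ^ γ) * al) *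
              (g * (V p + X')) := by gcongr
          have h4 : 0 ≤ (lam ^ (γ / 4) - lam ^ γ) * (g * (V p + X')) :=
            mul_nonneg (by linarith) (by positivity)
          have h5 : 0 ≤ A * γ * h := by positivity
          have h6 : 0 ≤ A * γ * (g * (V p + X')) := by positivity
          linarith

end GeometricBound

/-! ### Couplings, Wasserstein costs and `V`-norms -/

section Couplings

variable {S : Type*} [MeasurableSpace S]

lemma IsMarkovCoupling.pow_mem_transferencePlans {R : Kernel S S} {K : Kernel (S × S) (S × S)}
    (h : IsMarkovCoupling R K) (k : ℕ) (x y : S) :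
    (K ^ k) (x, y) ∈ transferencePlans ((R ^ k) x) ((R ^ k) y) := by
  obtain ⟨hR, hK, hRK⟩ := h
  induction k with
  | zero =>
    simp only [pow_zero]
    rw [show (1 : Kernel (S × S) (S × S)) = Kernel.id from rfl,
      show (1 : Kernel S S) = Kernel.id from rfl, Kernel.id_apply, Kernel.id_apply, Kernel.id_apply]
    exact ⟨Measure.map_dirac' measurable_fst _, Measure.map_dirac' measurable_snd _⟩
  | succ k ih =>
    constructor
    · ext s hs
      rw [Measure.map_apply measurable_fst hs, Kernel.pow_succ_apply_eq_lintegral _ _ _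
        (measurable_fst hs), Kernel.pow_succ_apply_eq_lintegral _ _ _ hs, ← ih.1,
        lintegral_map (Kernel.measurable_coe _ hs) measurable_fst]
      refine lintegral_congr fun q ↦ ?_
      rw [← (hRK q.1 q.2).1, Measure.map_apply measurable_fst hs]
    · ext s hs
      rw [Measure.map_apply measurable_snd hs, Kernel.pow_succ_apply_eq_lintegral _ _ _
        (measurable_snd hs), Kernel.pow_succ_apply_eq_lintegral _ _ _ hs, ← ih.2,
        lintegral_map (Kernel.measurable_coe _ hs) measurable_snd]
      refine lintegral_congr fun q ↦ ?_
      rw [← (hRK q.1 q.2).2, Measure.map_apply measurable_snd hs]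

/-- A coupling whose cost `1_{x ≠ y} (W x + W y) / 2` is integrated controls the `W`-norm. The
finiteness of `∫ V dζ` makes the test functions integrable, so that the integrals in `vNormDist`
are genuine. -/
lemma vNormDist_le_lintegral {μ ν : Measure S} {ζ : Measure (S × S)}
    (hζ : ζ ∈ transferencePlans μ ν) {V : S × S → ℝ} {W : S → ℝ} (hW : ∀ x, 0 ≤ W x)
    (hVm : Measurable V) (hVW : ∀ x y, V (x, y) = (W x + W y) / 2)
    (hfin : ∫⁻ p, ENNReal.ofReal (V p) ∂ζ ≠ ⊤) :
    vNormDist W μ ν ≤ ∫⁻ p, ENNReal.ofReal (offDiagCost V p) ∂ζ := by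
  have hV0 : ∀ p, 0 ≤ V p := fun p ↦ by
    rw [show p = (p.1, p.2) from rfl, hVW]; linarith [hW p.1, hW p.2]
  have hint : Integrable V ζ := by
    refine ⟨hVm.aestronglyMeasurable, ?_⟩
    rw [hasFiniteIntegral_iff_ofReal (Filter.Eventually.of_forall hV0)]
    exact hfin.lt_top
  have key : ∀ f : S → ℝ, Measurable f → (∀ x, |f x| ≤ W x) →
      ENNReal.ofReal |∫ x, f x ∂μ - ∫ x, f x ∂ν|
        ≤ 2 * ∫⁻ p, ENNReal.ofReal (offDiagCost V p) ∂ζ := by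
    intro f hf hfW
    have h1 : Integrable (fun p : S × S ↦ f p.1) ζ := by
      refine (hint.const_mul 2).mono' (hf.comp measurable_fst).aestronglyMeasurable
        (Filter.Eventually.of_forall fun p ↦ ?_)
      have := hVW p.1 p.2
      have h2 := hfW p.1
      have h3 := hW p.2
      rw [Real.norm_eq_abs]; linarith
    have h2 : Integrable (fun p : S × S ↦ f p.2) ζ := by
      refine (hint.const_mul 2).mono' (hf.comp measurable_snd).aestronglyMeasurable
        (Filter.Eventually.of_forall fun p ↦ ?_)
      have := hVW p.1 p.2
      have h2 := hfW p.2
      have h3 := hW p.1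
      rw [Real.norm_eq_abs]; linarith
    rw [← hζ.1, ← hζ.2, integral_map measurable_fst.aemeasurable hf.aestronglyMeasurable,
      integral_map measurable_snd.aemeasurable hf.aestronglyMeasurable, ← integral_sub h1 h2,
      ← Real.norm_eq_abs, ofReal_norm]
    refine (enorm_integral_le_lintegral_enorm _).trans ?_
    rw [← lintegral_const_mul' _ _ (by simp)]
    refine lintegral_mono fun p ↦ ?_
    dsimp only
    rw [← ofReal_norm, show (2 : ℝ≥0∞) = ENNReal.ofReal 2 by simp,
      ← ENNReal.ofReal_mul (by norm_num)]
    refine ENNReal.ofReal_le_ofReal ?_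
    obtain ⟨x, y⟩ := p
    by_cases hxy : x = y
    · subst hxy; simp [offDiagCost]
    · have : offDiagCost V (x, y) = V (x, y) := by simp [offDiagCost, hxy]
      rw [this, hVW, Real.norm_eq_abs]
      linarith [abs_sub (f x) (f y), hfW x, hfW y]
  rw [vNormDist]
  calc _ ≤ 2⁻¹ * (2 * ∫⁻ p, ENNReal.ofReal (offDiagCost V p) ∂ζ) := by
        gcongr
        exact iSup_le fun f ↦ iSup_le fun hf ↦ iSup_le fun hfW ↦ key f hf hfW
    _ = _ := by
        rw [← mul_assoc, ENNReal.inv_mul_cancel (by simp) (by simp), one_mul]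

end Couplings

section ConvergenceOfDrift

variable {d : ℕ} {X : Set (Eucl d)} {R : ℝ → Kernel X X} {K : ℝ → Kernel (X × X) (X × X)}
    {γbar lam A M : ℝ} {V : X × X → ℝ} {C : Set (X × X)} {Ψ : ℝ → ℕ → ℝ → ℝ}

lemma mul_ceil_le {γ : ℝ} (hγ : γ ∈ Ioc 0 γbar) (ℓ : ℕ) :
    γ * ((ℓ * ⌈1 / γ⌉₊ : ℕ) : ℝ) ≤ (1 + γbar) * ℓ := by
  have h := (Nat.ceil_lt_add_one (one_div_pos.2 hγ.1).le).le
  push_cast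
  calc γ * (ℓ * ⌈1 / γ⌉₊) ≤ γ * (ℓ * (1 / γ + 1)) := by gcongr; exact hγ.1.le
    _ = (1 + γ) * ℓ := by have := hγ.1.ne'; field_simp
    _ ≤ (1 + γbar) * ℓ := by gcongr; exact hγ.2

lemma le_mul_ceil {γ : ℝ} (hγ : 0 < γ) (ℓ : ℕ) : (ℓ : ℝ) ≤ γ * ((ℓ * ⌈1 / γ⌉₊ : ℕ) : ℝ) := by
  have h := Nat.le_ceil (1 / γ)
  push_cast
  calc (ℓ : ℝ) = γ * (ℓ * (1 / γ)) := by field_simp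
    _ ≤ _ := by gcongr

lemma one_le_mul_ceil {γ : ℝ} (hγ : 0 < γ) {ℓ : ℕ} (hℓ : 1 ≤ ℓ) : 1 ≤ ℓ * ⌈1 / γ⌉₊ :=
  Nat.mul_pos hℓ (Nat.ceil_pos.2 (one_div_pos.2 hγ))

lemma one_le_supOn (hV1 : ∀ p, 1 ≤ V p) (hC : C.Nonempty) (hB : BddAbove (V '' C)) :
    1 ≤ supOn V C := by
  obtain ⟨p, hp⟩ := hC
  exact (hV1 p).trans (le_csSup hB ⟨p, hp, rfl⟩)

lemma minorizationConst_le (h : DriftMinorization R K γbar lam A M V C Ψ) {γ : ℝ}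
    (hγ : γ ∈ Ioc 0 γbar) {ℓ : ℕ} (hℓ : 1 ≤ ℓ) {p : X × X} (hp : p ∈ closePairs X M) :
    minorizationConst X γbar M Ψ ℓ ≤ Ψ γ ℓ ‖(p.1 : Eucl d) - p.2‖ := by
  refine csInf_le ⟨0, ?_⟩ ⟨γ, hγ, p, hp, rfl⟩
  rintro r ⟨γ', hγ', q, hq, rfl⟩
  exact (h.Ψ_mem γ' hγ' ℓ hℓ _ (norm_nonneg _)).1

lemma lintegral_offDiagCost_le (h : DriftMinorization R K γbar lam A M V C Ψ) (hA : 1 ≤ A)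
    (hC : C.Nonempty) (hB : BddAbove (V '' C))
    (hε0 : ∀ ℓ : ℕ, 1 ≤ ℓ → 0 < minorizationConst X γbar M Ψ ℓ)
    (hε1 : X.Nontrivial → ∀ ℓ : ℕ, 1 ≤ ℓ → minorizationConst X γbar M Ψ ℓ < 1)
    {γ : ℝ} (hγ : γ ∈ Ioc 0 γbar) {ℓ : ℕ} (hℓ : 1 ≤ ℓ) {x y : X} (hxy : x ≠ y) (k : ℕ) :
    ∫⁻ p, ENNReal.ofReal (offDiagCost V p) ∂((K γ ^ k) (x, y))
      ≤ ENNReal.ofReal (lam ^ (k * γ / 4) *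
          (constD₁ γbar lam A * V (x, y) + constD₂ γbar lam A ℓ)
        + constC₁ γbar A (rateRho γbar lam A (supOn V C) (minorizationConst X γbar M Ψ ℓ) ℓ)
          * rateRho γbar lam A (supOn V C) (minorizationConst X γbar M Ψ ℓ) ℓ
            ^ (k * γ / 4)) := by
  have hX : X.Nontrivial := ⟨x, x.2, y, y.2, fun h ↦ hxy (Subtype.ext h)⟩
  have := (h.coupling γ hγ).2.1
  refine lintegral_pow_indicator_compl_le (K := K γ) (D := diagonal X) (C := C)
    measurableSet_diagonal ?_ h.measurable_V h.one_le_V h.lam_mem.1 h.lam_mem.2 hA hγ.1 hγ.2 hℓ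
    (one_le_mul_ceil hγ.1 hℓ) (mul_ceil_le hγ ℓ) (one_le_supOn h.one_le_V hC hB)
    (fun p hp ↦ le_csSup hB ⟨p, hp, rfl⟩) (hε0 ℓ hℓ) (hε1 hX ℓ hℓ) (h.drift γ hγ) ?_ k ?_
  · rintro ⟨u, v⟩ huv
    rw [mem_diagonal_iff] at huv
    dsimp only at huv
    subst huv
    exact h.absorbing γ hγ u
  · intro p hp
    refine (h.minorization γ hγ ℓ hℓ p.1 p.2).trans (ENNReal.ofReal_le_ofReal ?_)
    linarith [minorizationConst_le h hγ hℓ (h.C_subset hp)]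
  · simpa using hxy

lemma lintegral_offDiagCost_self (h : DriftMinorization R K γbar lam A M V C Ψ)
    {γ : ℝ} (hγ : γ ∈ Ioc 0 γbar) (x : X) (k : ℕ) :
    ∫⁻ p, ENNReal.ofReal (offDiagCost V p) ∂((K γ ^ k) (x, x)) = 0 := by
  have := (h.coupling γ hγ).2.1
  have h0 : (K γ ^ k) (x, x) (diagonal X)ᶜ = 0 := by
    refine pow_compl_eq_zero measurableSet_diagonal ?_ k (by simp)
    rintro ⟨u, v⟩ huv
    rw [mem_diagonal_iff] at huv
    dsimp only at huv
    subst huv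
    exact h.absorbing γ hγ u
  have hae : ∀ᵐ p ∂((K γ ^ k) (x, x)), p ∈ diagonal X := by rwa [ae_iff]
  rw [← lintegral_zero (μ := (K γ ^ k) (x, x))]
  refine lintegral_congr_ae ?_
  filter_upwards [hae] with p hp
  simp [offDiagCost, hp]

lemma wassersteinCost_le_lintegral (h : DriftMinorization R K γbar lam A M V C Ψ)
    {γ : ℝ} (hγ : γ ∈ Ioc 0 γbar) (x y : X) (k : ℕ) :
    wassersteinCost (offDiagCost V) ((R γ ^ k) x) ((R γ ^ k) y)
      ≤ ∫⁻ p, ENNReal.ofReal (offDiagCost V p) ∂((K γ ^ k) (x, y)) :=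
  iInf₂_le _ ((h.coupling γ hγ).pow_mem_transferencePlans k x y)

/-- `1 ≤ A` ensures that the term `A * lam ^ (-(1 + γbar) * ℓ) * (1 + γbar) * ℓ` of `constC` and
`constD₂` dominates `lam ^ (-γ * N)` for `N = ℓ * ⌈1 / γ⌉₊`, the price of waiting for the first
opportunity to meet. -/
theorem DriftMinorization.quantitativeConvergence
    (h : DriftMinorization R K γbar lam A M V C Ψ) (hγbar : 0 < γbar) (hA : 1 ≤ A)
    (hC : C.Nonempty) (hB : BddAbove (V '' C))
    (hε0 : ∀ ℓ : ℕ, 1 ≤ ℓ → 0 < minorizationConst X γbar M Ψ ℓ)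
    (hε1 : X.Nontrivial → ∀ ℓ : ℕ, 1 ≤ ℓ → minorizationConst X γbar M Ψ ℓ < 1) :
    QuantitativeConvergence R K γbar lam A M V C Ψ where
  wasserstein_le γ hγ x y k := wassersteinCost_le_lintegral h hγ x y k
  coupling_le γ hγ ℓ hℓ x y k := by
    by_cases hxy : x = y
    · subst hxy
      rw [lintegral_offDiagCost_self h hγ x k]
      exact zero_le
    · refine (lintegral_offDiagCost_le h hA hC hB hε0 hε1 hγ hℓ hxy k).trans_eq ?_
      simp [offDiagCost, hxy]
  rate_le hγ1 ℓ hℓ hε := by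
    have := Real.exp_pos (-1)
    exact inv_log_inv_rateRho_le h.lam_mem.1 h.lam_mem.2 h.A_nonneg
      (one_le_supOn h.one_le_V hC hB) hγbar.le hγ1 (hε0 ℓ hℓ) (by linarith)

/-- For `x ≠ y`, all the terms of the quantitative bound are dominated by the slowest rate and by
the cost itself. -/
lemma lintegral_offDiagCost_le_rate (h : DriftMinorization R K γbar lam A M V C Ψ)
    (hγbar : 0 < γbar) (hA : 1 ≤ A) (hC : C.Nonempty) (hB : BddAbove (V '' C))
    (hε0 : ∀ ℓ : ℕ, 1 ≤ ℓ → 0 < minorizationConst X γbar M Ψ ℓ)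
    (hε1 : X.Nontrivial → ∀ ℓ : ℕ, 1 ≤ ℓ → minorizationConst X γbar M Ψ ℓ < 1)
    {γ : ℝ} (hγ : γ ∈ Ioc 0 γbar) {ℓ : ℕ} (hℓ : 1 ≤ ℓ) (x y : X) (k : ℕ) :
    ∫⁻ p, ENNReal.ofReal (offDiagCost V p) ∂((K γ ^ k) (x, y))
      ≤ ENNReal.ofReal
        (rateRho γbar lam A (supOn V C) (minorizationConst X γbar M Ψ ℓ) ℓ ^ (k * γ / 4)
          * (constD₁ γbar lam A + constD₂ γbar lam A ℓ
            + constC₁ γbar A (rateRho γbar lam A (supOn V C) (minorizationConst X γbar M Ψ ℓ) ℓ))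
          * offDiagCost V (x, y)) := by
  by_cases hxy : x = y
  · subst hxy
    rw [lintegral_offDiagCost_self h hγ x k]
    exact zero_le
  refine (lintegral_offDiagCost_le h hA hC hB hε0 hε1 hγ hℓ hxy k).trans
    (ENNReal.ofReal_le_ofReal ?_)
  have hX : X.Nontrivial := ⟨x, x.2, y, y.2, fun h ↦ hxy (Subtype.ext h)⟩
  have hρ := rateRho_mem (ℓ := ℓ) h.lam_mem.1 h.lam_mem.2 h.A_nonneg
    (one_le_supOn h.one_le_V hC hB) hγbar.le (hε0 ℓ hℓ) (hε1 hX ℓ hℓ)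
  set ρ := rateRho γbar lam A (supOn V C) (minorizationConst X γbar M Ψ ℓ) ℓ
  have hl := h.lam_mem.1
  have hρ0 : 0 < ρ := hl.trans_le hρ.1
  have hV1 := h.one_le_V (x, y)
  have hlogl : 0 < Real.log (1 / lam) :=
    Real.log_pos (by rw [lt_div_iff₀ hl]; linarith [h.lam_mem.2])
  have hlogρ : 0 < Real.log (1 / ρ) := Real.log_pos (by rw [lt_div_iff₀ hρ0]; linarith [hρ.2])
  have hD1 : 0 ≤ constD₁ γbar lam A := by rw [constD₁]; positivity
  have hD2 : 0 ≤ constD₂ γbar lam A ℓ := by rw [constD₂]; positivity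
  have hC1 : 0 ≤ constC₁ γbar A ρ := by rw [constC₁]; positivity
  have hcost : offDiagCost V (x, y) = V (x, y) := by simp [offDiagCost, hxy]
  have hγ0 := hγ.1
  have hpow : lam ^ (k * γ / 4) ≤ ρ ^ (k * γ / 4) :=
    Real.rpow_le_rpow hl.le hρ.1 (by positivity)
  have hg0 : 0 < ρ ^ (k * γ / 4) := Real.rpow_pos_of_pos hρ0 _
  rw [hcost]
  calc _ ≤ ρ ^ (k * γ / 4) * (constD₁ γbar lam A * V (x, y) + constD₂ γbar lam A ℓ * V (x, y))
        + constC₁ γbar A ρ * ρ ^ (k * γ / 4) * V (x, y) := by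
        refine add_le_add ?_ (le_mul_of_one_le_right (by positivity) hV1)
        gcongr
        exact le_mul_of_one_le_right hD2 hV1
    _ = _ := by ring

theorem DriftMinorization.uniformGeometricConvergence
    (h : DriftMinorization R K γbar lam A M V C Ψ) (hγbar : 0 < γbar) (hA : 1 ≤ A)
    (hC : C.Nonempty) (hB : BddAbove (V '' C))
    (hε0 : ∀ ℓ : ℕ, 1 ≤ ℓ → 0 < minorizationConst X γbar M Ψ ℓ)
    (hε1 : X.Nontrivial → ∀ ℓ : ℕ, 1 ≤ ℓ → minorizationConst X γbar M Ψ ℓ < 1)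
    {W : X → ℝ} (hW : ∀ x, 0 ≤ W x) (hVW : ∀ x y, V (x, y) = (W x + W y) / 2) :
    UniformGeometricConvergence R γbar lam A M W C Ψ V where
  const_pos := hε0
  rate_mem hX ℓ hℓ := ⟨hε1 hX ℓ hℓ, rateRho_mem h.lam_mem.1 h.lam_mem.2 h.A_nonneg
    (one_le_supOn h.one_le_V hC hB) hγbar.le (hε0 ℓ hℓ) (hε1 hX ℓ hℓ)⟩
  cost_eq := hVW
  wasserstein_le γ hγ ℓ hℓ x y k := (wassersteinCost_le_lintegral h hγ x y k).trans
    (lintegral_offDiagCost_le_rate h hγbar hA hC hB hε0 hε1 hγ hℓ x y k)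
  vNorm_le γ hγ ℓ hℓ x y k := by
    refine (vNormDist_le_lintegral ((h.coupling γ hγ).pow_mem_transferencePlans k x y) hW
      h.measurable_V hVW ?_).trans
        (lintegral_offDiagCost_le_rate h hγbar hA hC hB hε0 hε1 hγ hℓ x y k)
    have := (h.coupling γ hγ).2.1
    have hγ0 := hγ.1
    have hl := h.lam_mem.1
    have hA0 := h.A_nonneg
    have hβ1 : lam ^ γ ≤ 1 := Real.rpow_le_one hl.le h.lam_mem.2.le hγ0.le
    refine ne_top_of_le_ne_top ?_ (lintegral_pow_le_of_drift (K := K γ)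
      h.measurable_V.ennreal_ofReal (ENNReal.ofReal_le_one.2 hβ1)
      (a := ENNReal.ofReal (A * γ)) ?_ k (x, y))
    · finiteness
    · intro p
      have hV1 := h.one_le_V p
      refine (h.drift γ hγ p).trans ?_
      rw [← ENNReal.ofReal_mul (by positivity), ← ENNReal.ofReal_add (by positivity)
        (by positivity)]
      refine ENNReal.ofReal_le_ofReal ?_
      gcongr
      exact indicator_le_self' (fun _ _ ↦ by positivity) _

end ConvergenceOfDrift

/-! ### Gaussian vectors along a direction -/

section GaussianDirection

open scoped RealInnerProductSpace

variable {E : Type*} [NormedAddCommGroup E] [InnerProductSpace ℝ E] [FiniteDimensional ℝ E]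
  [MeasurableSpace E] [BorelSpace E]

/-- A scaled standard Gaussian vector has independent Gaussian components along a unit vector `e`
and orthogonally to it. -/
lemma stdGaussian_map_smul_eq {e : E} (he : ‖e‖ = 1) (c : ℝ) {v : NNReal} (hv : (v : ℝ) = c ^ 2) :
    (stdGaussian E).map (fun z ↦ c • z) = ((gaussianReal 0 v).prod (stdGaussian E)).map
      (fun q ↦ q.1 • e + c • (q.2 - ⟪e, q.2⟫ • e)) := by
  have : IsProbabilityMeasure ((stdGaussian E).map (fun z ↦ c • z)) :=
    Measure.isProbabilityMeasure_map (by fun_prop)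
  have : IsProbabilityMeasure (((gaussianReal 0 v).prod (stdGaussian E)).map
      (fun q ↦ q.1 • e + c • (q.2 - ⟪e, q.2⟫ • e))) :=
    Measure.isProbabilityMeasure_map (Measurable.aemeasurable (by fun_prop))
  refine Measure.ext_of_charFun (funext fun t ↦ ?_)
  rw [charFun_map_smul, charFun_stdGaussian, charFun_apply, integral_map
    (Measurable.aemeasurable (by fun_prop)) (Measurable.aestronglyMeasurable (by fun_prop))]
  have h (q : ℝ × E) : Complex.exp (⟪q.1 • e + c • (q.2 - ⟪e, q.2⟫ • e), t⟫ * Complex.I)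
      = Complex.exp (⟪e, t⟫ * q.1 * Complex.I) *
        Complex.exp (⟪q.2, c • (t - ⟪e, t⟫ • e)⟫ * Complex.I) := by
    rw [← Complex.exp_add]
    congr 1
    rw [← add_mul, ← Complex.ofReal_mul, ← Complex.ofReal_add]
    congr 2
    simp only [inner_add_left, inner_smul_left, inner_sub_left, inner_smul_right, inner_sub_right,
      RCLike.conj_to_real]
    rw [real_inner_comm e q.2]
    ring
  simp_rw [h]
  rw [integral_prod_mul (fun s : ℝ ↦ Complex.exp (⟪e, t⟫ * s * Complex.I))
    (fun w : E ↦ Complex.exp (⟪w, c • (t - ⟪e, t⟫ • e)⟫ * Complex.I)), ← charFun_apply_real,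
    ← charFun_apply, charFun_gaussianReal, charFun_stdGaussian, ← Complex.exp_add]
  congr 1
  have h2 : ‖c • t‖ ^ 2 = v * ⟪e, t⟫ ^ 2 + ‖c • (t - ⟪e, t⟫ • e)‖ ^ 2 := by
    rw [norm_smul, norm_smul, mul_pow, mul_pow, norm_sub_sq_real, norm_smul, inner_smul_right, he,
      hv, real_inner_comm t e]
    simp only [Real.norm_eq_abs, sq_abs, mul_one]
    ring
  have h3 : ((‖c • t‖ : ℂ)) ^ 2 = v * (⟪e, t⟫ : ℂ) ^ 2 + (‖c • (t - ⟪e, t⟫ • e)‖ : ℂ) ^ 2 := by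
    exact_mod_cast h2
  rw [h3]
  push_cast
  ring

lemma lintegral_stdGaussian_smul {e : E} (he : ‖e‖ = 1) (c : ℝ) {v : NNReal}
    (hv : (v : ℝ) = c ^ 2) {F : E → ℝ≥0∞} (hF : Measurable F) :
    ∫⁻ z, F (c • z) ∂(stdGaussian E) = ∫⁻ w, ∫⁻ s, F (s • e + c • (w - ⟪e, w⟫ • e))
      ∂(gaussianReal 0 v) ∂(stdGaussian E) := by
  rw [← lintegral_map hF (by fun_prop), stdGaussian_map_smul_eq he c hv,
    lintegral_map hF (by fun_prop), lintegral_prod_symm _ (by fun_prop)]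

end GaussianDirection

section GaussianReal

variable {v : NNReal}

lemma lintegral_gaussianReal_neg (F : ℝ → ℝ≥0∞) :
    ∫⁻ s, F (-s) ∂(gaussianReal 0 v) = ∫⁻ s, F s ∂(gaussianReal 0 v) := by
  have h : (gaussianReal 0 v).map (MeasurableEquiv.neg ℝ) = gaussianReal 0 v := by
    simpa using gaussianReal_map_neg (μ := 0) (v := v)
  conv_rhs => rw [← h, lintegral_map_equiv]
  rfl

lemma integral_gaussianReal_neg (F : ℝ → ℝ) :
    ∫ s, F (-s) ∂(gaussianReal 0 v) = ∫ s, F s ∂(gaussianReal 0 v) := by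
  have h : (gaussianReal 0 v).map (MeasurableEquiv.neg ℝ) = gaussianReal 0 v := by
    simpa using gaussianReal_map_neg (μ := 0) (v := v)
  conv_rhs => rw [← h, integral_map_equiv]
  rfl

/-- The acceptance probability `1 ∧ φ(a - s) / φ(s)` for the centred Gaussian density `φ` with
variance `v`: the density, with respect to `N(0, v)`, of the common part of `N(0, v)` and
`N(a, v)`. -/
noncomputable def overlapProb (v : NNReal) (a s : ℝ) : ℝ :=
  min 1 (gaussianPDFReal 0 v (a - s) / gaussianPDFReal 0 v s)

lemma overlapProb_nonneg (a s : ℝ) : 0 ≤ overlapProb v a s :=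
  le_min zero_le_one (div_nonneg (gaussianPDFReal_nonneg _ _ _) (gaussianPDFReal_nonneg _ _ _))

lemma overlapProb_le_one (a s : ℝ) : overlapProb v a s ≤ 1 := min_le_left _ _

@[fun_prop]
lemma measurable_overlapProb (a : ℝ) : Measurable (overlapProb v a) :=
  measurable_const.min (((measurable_gaussianPDFReal 0 v).comp (by fun_prop)).div
    (measurable_gaussianPDFReal 0 v))

lemma gaussianPDFReal_mul_overlapProb (hv : v ≠ 0) (a s : ℝ) :
    gaussianPDFReal 0 v s * overlapProb v a s
      = min (gaussianPDFReal 0 v s) (gaussianPDFReal 0 v (a - s)) := by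
  have h := gaussianPDFReal_pos 0 v s hv
  rw [overlapProb, mul_min_of_nonneg _ _ h.le, mul_one, mul_div_cancel₀ _ h.ne']

lemma gaussianPDFReal_mul_overlapProb_symm (hv : v ≠ 0) (a s : ℝ) :
    gaussianPDFReal 0 v (a - s) * overlapProb v a (a - s)
      = gaussianPDFReal 0 v s * overlapProb v a s := by
  rw [gaussianPDFReal_mul_overlapProb hv, gaussianPDFReal_mul_overlapProb hv, sub_sub_cancel,
    min_comm]

lemma overlapProb_eq_one {a s : ℝ} (hv : v ≠ 0) (h : a ≤ 2 * s) (ha : 0 ≤ a) :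
    overlapProb v a s = 1 := by
  refine min_eq_left ?_
  have hs := gaussianPDFReal_pos 0 v s hv
  rw [le_div_iff₀ hs, one_mul, gaussianPDFReal, gaussianPDFReal]
  refine mul_le_mul_of_nonneg_left (Real.exp_le_exp.2 ?_) (by positivity)
  exact div_le_div_of_nonneg_right (by nlinarith) (by positivity)

/-- The common part of `N(0, v)` and `N(a, v)` is invariant under `s ↦ a - s`. -/
lemma lintegral_overlapProb_mul (hv : v ≠ 0) (a : ℝ) {H : ℝ → ℝ≥0∞} (hH : Measurable H) :
    ∫⁻ s, ENNReal.ofReal (overlapProb v a s) * H s ∂(gaussianReal 0 v)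
      = ∫⁻ s, ENNReal.ofReal (overlapProb v a s) * H (a - s) ∂(gaussianReal 0 v) := by
  have key (H : ℝ → ℝ≥0∞) (hH : Measurable H) :
      ∫⁻ s, ENNReal.ofReal (overlapProb v a s) * H s ∂(gaussianReal 0 v)
      = ∫⁻ s, ENNReal.ofReal (gaussianPDFReal 0 v s * overlapProb v a s) * H s := by
    rw [gaussianReal_of_var_ne_zero _ hv, lintegral_withDensity_eq_lintegral_mul _
      (measurable_gaussianPDF 0 v) (by fun_prop)]
    refine lintegral_congr fun s ↦ ?_
    rw [Pi.mul_apply, gaussianPDF, ENNReal.ofReal_mul (gaussianPDFReal_nonneg _ _ _), mul_assoc]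
  rw [key H hH, key (fun s ↦ H (a - s)) (by fun_prop), ← lintegral_sub_left_eq_self _ a]
  simp_rw [gaussianPDFReal_mul_overlapProb_symm hv]

lemma integral_overlapProb_mul (hv : v ≠ 0) (a : ℝ) (H : ℝ → ℝ) :
    ∫ s, overlapProb v a s * H s ∂(gaussianReal 0 v)
      = ∫ s, overlapProb v a s * H (a - s) ∂(gaussianReal 0 v) := by
  simp_rw [integral_gaussianReal_eq_integral_smul hv, smul_eq_mul, ← mul_assoc]
  rw [← integral_sub_left_eq_self _ _ a]
  simp_rw [gaussianPDFReal_mul_overlapProb_symm hv]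

end GaussianReal

/-! ### The odd Gaussian profile -/

section SignMean

/-- The mean of `sign (t - 2 W)` for `W` of law `N(0, v)`. For `0 < v` it is
`1 - 2 Φ(-t / (2 √v))`, the total variation distance of `N(0, v)` and `N(t, v)` when `0 ≤ t`; for
`v = 0` it is `sign t`, so that on distances it is the indicator of being distinct. -/
noncomputable def signMean (v : NNReal) (t : ℝ) : ℝ :=
  ∫ w, Real.sign (t - 2 * w) ∂(gaussianReal 0 v)

@[fun_prop]
lemma measurable_sign : Measurable Real.sign :=
  Measurable.ite measurableSet_Iio measurable_const
    (Measurable.ite measurableSet_Ioi measurable_const measurable_const)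

lemma abs_sign_le_one (r : ℝ) : |Real.sign r| ≤ 1 := by
  rcases Real.sign_apply_eq r with h | h | h <;> simp [h]

lemma monotone_sign : Monotone Real.sign := by
  intro r s h
  rcases lt_trichotomy r 0 with hr | rfl | hr
  · rw [Real.sign_of_neg hr]; exact (abs_le.1 (abs_sign_le_one s)).1
  · rw [Real.sign_zero]
    rcases h.eq_or_lt with rfl | h
    · simp
    · simp [Real.sign_of_pos h]
  · rw [Real.sign_of_pos hr, Real.sign_of_pos (hr.trans_le h)]

variable {v u : NNReal}

lemma integrable_of_measurable_of_abs_le_one {Ω : Type*} [MeasurableSpace Ω] {μ : Measure Ω}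
    [IsFiniteMeasure μ] {f : Ω → ℝ} (hf : Measurable f) (h : ∀ x, |f x| ≤ 1) : Integrable f μ :=
  Integrable.of_bound hf.aestronglyMeasurable 1 (Filter.Eventually.of_forall h)

lemma integrable_sign (t : ℝ) :
    Integrable (fun w ↦ Real.sign (t - 2 * w)) (gaussianReal 0 v) :=
  integrable_of_measurable_of_abs_le_one (by fun_prop) fun _ ↦ abs_sign_le_one _

lemma monotone_signMean : Monotone (signMean v) := fun s t h ↦
  integral_mono (integrable_sign s) (integrable_sign t) fun w ↦
    monotone_sign (by linarith)

@[fun_prop]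
lemma measurable_signMean : Measurable (signMean v) := monotone_signMean.measurable

lemma signMean_neg (t : ℝ) : signMean v (-t) = -signMean v t := by
  rw [signMean, signMean, ← integral_neg, ← integral_gaussianReal_neg]
  refine integral_congr_ae (Filter.Eventually.of_forall fun w ↦ ?_)
  dsimp only
  rw [← Real.sign_neg]
  congr 1; ring

lemma signMean_zero : signMean v 0 = 0 := by
  have := signMean_neg (v := v) 0
  rw [neg_zero] at this; linarith

lemma signMean_nonneg {t : ℝ} (ht : 0 ≤ t) : 0 ≤ signMean v t :=
  signMean_zero (v := v) ▸ monotone_signMean ht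

lemma abs_signMean_le_one (t : ℝ) : |signMean v t| ≤ 1 := by
  have := norm_integral_le_of_norm_le_const (μ := gaussianReal 0 v) (C := 1)
    (f := fun w ↦ Real.sign (t - 2 * w)) (Filter.Eventually.of_forall fun w ↦ abs_sign_le_one _)
  simpa [signMean] using this

lemma signMean_zero_var (t : ℝ) : signMean 0 t = Real.sign t := by
  rw [signMean, gaussianReal_zero_var, integral_dirac]; simp

/-- The semigroup property of the profile, from the convolution of Gaussian laws. -/
lemma signMean_add (t : ℝ) :
    signMean (v + u) t = ∫ s, signMean v (t - 2 * s) ∂(gaussianReal 0 u) := by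
  have h := gaussianReal_conv_gaussianReal (m₁ := 0) (m₂ := 0) (v₁ := u) (v₂ := v)
  rw [add_zero, add_comm] at h
  rw [signMean, ← h, Measure.conv, integral_map (by fun_prop)
    (Measurable.aestronglyMeasurable (by fun_prop)), integral_prod _
      (integrable_of_measurable_of_abs_le_one (by fun_prop) fun _ ↦ abs_sign_le_one _)]
  refine integral_congr_ae (Filter.Eventually.of_forall fun s ↦ ?_)
  dsimp only [signMean]
  refine integral_congr_ae (Filter.Eventually.of_forall fun w ↦ ?_)
  dsimp only
  congr 1; ring

lemma signMean_scale {w : NNReal} {c : ℝ} (hc : 0 < c) (hw : (w : ℝ) = c ^ 2 * v) (t : ℝ) :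
    signMean w (c * t) = signMean v t := by
  have h := gaussianReal_map_const_mul (μ := 0) (v := v) c
  rw [mul_zero, show NNReal.mk (c ^ 2) (sq_nonneg c) * v = w from NNReal.eq hw.symm] at h
  rw [signMean, ← h, integral_map (by fun_prop) (Measurable.aestronglyMeasurable (by fun_prop)),
    signMean]
  refine integral_congr_ae (Filter.Eventually.of_forall fun w ↦ ?_)
  dsimp only
  rw [show c * t - 2 * (c * w) = c * (t - 2 * w) by ring]
  rcases lt_trichotomy (t - 2 * w) 0 with hr | hr | hr
  · rw [Real.sign_of_neg hr, Real.sign_of_neg (mul_neg_of_pos_of_neg hc hr)]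
  · rw [hr, mul_zero]
  · rw [Real.sign_of_pos hr, Real.sign_of_pos (mul_pos hc hr)]

lemma signMean_one (t : ℝ) : signMean 1 t = 1 - 2 * stdNormalCdf (-(t / 2)) := by
  have h1 : (gaussianReal 0 1).real (Ioi (t / 2)) = stdNormalCdf (-(t / 2)) := by
    rw [stdNormalCdf, cdf_eq_real, measureReal_def, measureReal_def]
    congr 1
    have h : (gaussianReal 0 1).map (fun x ↦ -x) = gaussianReal 0 1 := by
      simpa using gaussianReal_map_neg (μ := 0) (v := 1)
    have : NullSingletonClass (gaussianReal 0 1) := nullSingletonClass_gaussianReal one_ne_zero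
    rw [← Iio_ae_eq_Iic.measure_eq, ← h, Measure.map_apply (by fun_prop) measurableSet_Ioi,
      Measure.map_apply (by fun_prop) measurableSet_Iio, ← h,
      Measure.map_apply (by fun_prop) (measurableSet_Iio.preimage (by fun_prop)), h]
    congr 1; ext x; simp
  have : NullSingletonClass (gaussianReal 0 1) := nullSingletonClass_gaussianReal one_ne_zero
  have hne : ∀ᵐ w ∂(gaussianReal 0 1), w ≠ t / 2 := by
    rw [ae_iff]; simp
  have h2 : ∀ᵐ w ∂(gaussianReal 0 1),
      Real.sign (t - 2 * w) = 1 - 2 * (Ioi (t / 2)).indicator 1 w := by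
    filter_upwards [hne] with w hw
    rcases lt_or_gt_of_ne hw with hw | hw
    · rw [Real.sign_of_pos (by linarith), indicator_of_notMem (by simp [hw.le])]; simp
    · rw [Real.sign_of_neg (by linarith), indicator_of_mem (by simpa using hw)]; norm_num
  rw [signMean, integral_congr_ae h2, integral_sub (integrable_const _), integral_const_mul,
    integral_indicator_one measurableSet_Ioi, h1]
  · simp
  · exact ((integrable_indicator_iff measurableSet_Ioi).2
      (integrable_const (1 : ℝ)).integrableOn).const_mul 2

lemma signMean_eq (hv : v ≠ 0) (t : ℝ) :
    signMean v t = 1 - 2 * stdNormalCdf (-(t / (2 * √(v : ℝ)))) := by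
  have hv0 : 0 < (v : ℝ) := by positivity
  have hs : 0 < √(v : ℝ) := Real.sqrt_pos.2 hv0
  have h := signMean_scale (v := 1) (w := v) hs (by rw [Real.sq_sqrt hv0.le]; simp)
    (t / √(v : ℝ))
  rw [mul_div_cancel₀ _ hs.ne'] at h
  rw [h, signMean_one, div_div, mul_comm √(v : ℝ) 2]

/-- One reflected Gaussian move of variance `u`, which is kept only off the common part, turns the
profile of variance `v` at distance `|a - 2 s|` into the profile of variance `v + u` at distance
`a`: the integrand extends oddly about `s = a / 2`. -/
lemma lintegral_overlapProb_signMean (hu : u ≠ 0) {a : ℝ} (ha : 0 ≤ a) :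
    ∫⁻ s, ENNReal.ofReal (1 - overlapProb u a s) * ENNReal.ofReal (signMean v |a - 2 * s|)
      ∂(gaussianReal 0 u) = ENNReal.ofReal (signMean (v + u) a) := by
  have h1 (s : ℝ) : ENNReal.ofReal (1 - overlapProb u a s) * ENNReal.ofReal (signMean v |a - 2 * s|)
      = ENNReal.ofReal ((1 - overlapProb u a s) * signMean v (a - 2 * s)) := by
    rw [← ENNReal.ofReal_mul (sub_nonneg.2 (overlapProb_le_one a s))]
    rcases le_total a (2 * s) with h | h
    · simp [overlapProb_eq_one hu h ha]
    · rw [abs_of_nonneg (by linarith)]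
  have h0 (s : ℝ) : 0 ≤ (1 - overlapProb u a s) * signMean v (a - 2 * s) := by
    rcases le_total a (2 * s) with h | h
    · simp [overlapProb_eq_one hu h ha]
    · exact mul_nonneg (sub_nonneg.2 (overlapProb_le_one a s)) (signMean_nonneg (by linarith))
  have hi1 : Integrable (fun s ↦ signMean v (a - 2 * s)) (gaussianReal 0 u) :=
    integrable_of_measurable_of_abs_le_one (by fun_prop) fun _ ↦ abs_signMean_le_one _
  have hi2 : Integrable (fun s ↦ overlapProb u a s * signMean v (a - 2 * s)) (gaussianReal 0 u) :=
    integrable_of_measurable_of_abs_le_one (by fun_prop) fun s ↦ by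
      rw [abs_mul, abs_of_nonneg (overlapProb_nonneg a s)]
      exact mul_le_one₀ (overlapProb_le_one a s) (abs_nonneg _) (abs_signMean_le_one _)
  -- the common part is symmetric about `a / 2`, where the profile is odd
  have hzero : ∫ s, overlapProb u a s * signMean v (a - 2 * s) ∂(gaussianReal 0 u) = 0 := by
    have h := integral_overlapProb_mul hu a (fun s ↦ signMean v (a - 2 * s))
    have h' (s : ℝ) : signMean v (a - 2 * (a - s)) = -signMean v (a - 2 * s) := by
      rw [← signMean_neg]; congr 1; ring
    simp_rw [h', mul_neg, integral_neg] at h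
    linarith
  have hsub (s : ℝ) : (1 - overlapProb u a s) * signMean v (a - 2 * s)
      = signMean v (a - 2 * s) - overlapProb u a s * signMean v (a - 2 * s) := by ring
  simp_rw [h1]
  rw [← ofReal_integral_eq_lintegral_ofReal _ (Filter.Eventually.of_forall h0)]
  · simp_rw [hsub]
    rw [integral_sub hi1 hi2, hzero, sub_zero, signMean_add]
  · simp_rw [hsub]
    exact hi1.sub hi2

end SignMean

/-! ### The metric projection -/

section Projection

variable {d : ℕ} {X : Set (Eucl d)}

lemma norm_projOnto_sub_le (hX : X.Nonempty) (hcl : IsClosed X) (u : Eucl d) {q : Eucl d}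
    (hq : q ∈ X) : ‖(projOnto X hX u : Eucl d) - u‖ ≤ ‖q - u‖ := by
  have : Nonempty X := hX.to_subtype
  have hex : ∃ p : X, ∀ q : X, ‖(p : Eucl d) - u‖ ≤ ‖(q : Eucl d) - u‖ := by
    obtain ⟨p, hp, hpd⟩ := hcl.exists_infDist_eq_dist hX u
    refine ⟨⟨p, hp⟩, fun q ↦ ?_⟩
    have h := Metric.infDist_le_dist_of_mem (x := u) q.2
    rw [hpd, dist_comm, dist_comm u, dist_eq_norm, dist_eq_norm] at h
    exact h
  exact Classical.epsilon_spec hex ⟨q, hq⟩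

lemma inner_sub_projOnto_le (hX : X.Nonempty) (hcl : IsClosed X) (hcv : Convex ℝ X) (u : Eucl d)
    {q : Eucl d} (hq : q ∈ X) :
    inner ℝ (u - projOnto X hX u) (q - projOnto X hX u) ≤ 0 := by
  have : Nonempty X := hX.to_subtype
  refine (norm_eq_iInf_iff_real_inner_le_zero hcv (projOnto X hX u).2).1 ?_ q hq
  refine le_antisymm (le_ciInf fun q ↦ ?_) (ciInf_le ⟨0, ?_⟩ (projOnto X hX u))
  · rw [norm_sub_rev, norm_sub_rev u]
    exact norm_projOnto_sub_le hX hcl u q.2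
  · rintro _ ⟨q, rfl⟩
    exact norm_nonneg _

lemma norm_projOnto_sub_projOnto_le (hX : X.Nonempty) (hcl : IsClosed X) (hcv : Convex ℝ X)
    (u v : Eucl d) : ‖(projOnto X hX u : Eucl d) - projOnto X hX v‖ ≤ ‖u - v‖ := by
  have h1 := inner_sub_projOnto_le hX hcl hcv u (projOnto X hX v).2
  have h2 := inner_sub_projOnto_le hX hcl hcv v (projOnto X hX u).2
  set p : Eucl d := ↑(projOnto X hX u)
  set q : Eucl d := ↑(projOnto X hX v)
  have h3 : inner ℝ (u - v) (p - q) = ‖p - q‖ ^ 2 - inner ℝ (u - p) (q - p)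
      - inner ℝ (v - q) (p - q) := by
    rw [← real_inner_self_eq_norm_sq]
    simp only [inner_sub_left, inner_sub_right]
    ring
  have h4 := real_inner_le_norm (u - v) (p - q)
  nlinarith [norm_nonneg (p - q), norm_nonneg (u - v)]

lemma measurable_projOnto (hX : X.Nonempty) (hcl : IsClosed X) (hcv : Convex ℝ X) :
    Measurable (projOnto X hX) := by
  have : LipschitzWith 1 (projOnto X hX) := LipschitzWith.of_dist_le_mul fun u v ↦ by
    rw [Subtype.dist_eq, dist_eq_norm, dist_eq_norm, NNReal.coe_one, one_mul]
    exact norm_projOnto_sub_projOnto_le hX hcl hcv u v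
  exact this.continuous.measurable

lemma norm_projOnto_le (hX : X.Nonempty) (hcl : IsClosed X) (hcv : Convex ℝ X)
    (h0 : (0 : Eucl d) ∈ X) (u : Eucl d) : ‖(projOnto X hX u : Eucl d)‖ ≤ ‖u‖ := by
  have h := norm_projOnto_sub_le hX hcl 0 h0
  have h' : (projOnto X hX 0 : Eucl d) = 0 := by simpa using h
  simpa [h'] using norm_projOnto_sub_projOnto_le hX hcl hcv u 0

end Projection

/-! ### The scheme and its reflection coupling -/

section SchemeKernels

variable {d : ℕ} {X : Set (Eucl d)} {b : Eucl d → Eucl d} {γ : ℝ}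

lemma continuous_eulerMap (hb : Continuous b) : Continuous (eulerMap b γ) := by
  unfold eulerMap; fun_prop

lemma measurable_reflectionStep (hb : Continuous b) :
    Measurable fun q : (Eucl d × Eucl d) × (Eucl d × ℝ) ↦
      reflectionStep b γ q.1.1 q.1.2 q.2.1 q.2.2 := by
  have hT : Measurable (eulerMap b γ) := (continuous_eulerMap hb).measurable
  have hdiff : Measurable fun q : (Eucl d × Eucl d) × (Eucl d × ℝ) ↦ eulerDiff b γ q.1.1 q.1.2 := by
    unfold eulerDiff; fun_prop
  have hdir : Measurable fun q : (Eucl d × Eucl d) × (Eucl d × ℝ) ↦ eulerDir b γ q.1.1 q.1.2 := by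
    unfold eulerDir; fun_prop
  have hpdf : Measurable (gaussianPDFReal 0 γ.toNNReal) := measurable_gaussianPDFReal _ _
  unfold reflectionStep
  refine Measurable.prodMk (by fun_prop) (Measurable.ite ?_ (by fun_prop) (Measurable.ite ?_
    (by fun_prop) ?_))
  · exact measurableSet_eq_fun (by fun_prop) (by fun_prop)
  · refine measurableSet_le (by fun_prop) ?_
    unfold couplingProb
    fun_prop
  · unfold reflectedMove
    fun_prop

lemma measurable_projEulerStep (hX : X.Nonempty) (hcl : IsClosed X) (hcv : Convex ℝ X)
    (hb : Continuous b) : Measurable fun q : X × Eucl d ↦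
      projOnto X hX (eulerMap b γ q.1 + √γ • q.2) := by
  have hT : Measurable (eulerMap b γ) := (continuous_eulerMap hb).measurable
  exact (measurable_projOnto hX hcl hcv).comp (by fun_prop)

lemma measurable_projReflectionStep (hX : X.Nonempty) (hcl : IsClosed X) (hcv : Convex ℝ X)
    (hb : Continuous b) : Measurable fun q : (X × X) × (Eucl d × unitInterval) ↦
      Prod.map (projOnto X hX) (projOnto X hX)
        (reflectionStep b γ q.1.1 q.1.2 q.2.1 q.2.2) := by
  have hP := measurable_projOnto hX hcl hcv
  have h : Measurable fun q : (X × X) × (Eucl d × unitInterval) ↦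
      (((q.1.1 : Eucl d), (q.1.2 : Eucl d)), (q.2.1, (q.2.2 : ℝ))) := by fun_prop
  exact (hP.prodMap hP).comp ((measurable_reflectionStep hb).comp h)

lemma isMarkovKernel_projEulerKernel (hX : X.Nonempty) (hcl : IsClosed X) (hcv : Convex ℝ X)
    (hb : Continuous b) : IsMarkovKernel (projEulerKernel X hX b γ) :=
  Kernel.IsMarkovKernel.map _ (measurable_projEulerStep hX hcl hcv hb)

lemma isMarkovKernel_reflectionCouplingKernel (hX : X.Nonempty) (hcl : IsClosed X)
    (hcv : Convex ℝ X) (hb : Continuous b) :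
    IsMarkovKernel (reflectionCouplingKernel X hX b γ) :=
  Kernel.IsMarkovKernel.map _ (measurable_projReflectionStep hX hcl hcv hb)

lemma lintegral_projEulerKernel (hX : X.Nonempty) (hcl : IsClosed X) (hcv : Convex ℝ X)
    (hb : Continuous b) (x : X) {f : X → ℝ≥0∞} (hf : Measurable f) :
    ∫⁻ q, f q ∂(projEulerKernel X hX b γ x)
      = ∫⁻ z, f (projOnto X hX (eulerMap b γ x + √γ • z)) ∂(stdGaussian (Eucl d)) := by
  have hm := measurable_projEulerStep (γ := γ) hX hcl hcv hb
  rw [projEulerKernel, Kernel.map_apply _ hm, Kernel.prod_apply, Kernel.id_apply,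
    Kernel.const_apply, lintegral_map hf hm, Measure.dirac_prod]
  exact lintegral_map (hf.comp hm) (by fun_prop)

lemma lintegral_reflectionCouplingKernel (hX : X.Nonempty) (hcl : IsClosed X) (hcv : Convex ℝ X)
    (hb : Continuous b) (x y : X) {f : X × X → ℝ≥0∞} (hf : Measurable f) :
    ∫⁻ q, f q ∂(reflectionCouplingKernel X hX b γ (x, y))
      = ∫⁻ z, (∫⁻ u : unitInterval, f (Prod.map (projOnto X hX) (projOnto X hX)
          (reflectionStep b γ x y z u))) ∂(stdGaussian (Eucl d)) := by
  have hm := measurable_projReflectionStep (γ := γ) hX hcl hcv hb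
  rw [reflectionCouplingKernel, Kernel.map_apply _ hm, Kernel.prod_apply, Kernel.id_apply,
    Kernel.const_apply, lintegral_map hf hm, Measure.dirac_prod]
  refine (lintegral_map (hf.comp hm) (by fun_prop)).trans (lintegral_prod _ ?_)
  exact ((hf.comp hm).comp (by fun_prop : Measurable (Prod.mk (x, y)))).aemeasurable

lemma reflectionStep_of_eq {x y z : Eucl d} {u : ℝ} (h : eulerMap b γ x = eulerMap b γ y) :
    reflectionStep b γ x y z u = (eulerMap b γ x + √γ • z, eulerMap b γ x + √γ • z) := by
  simp [reflectionStep, h]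

lemma reflectionCouplingKernel_diagonal (hX : X.Nonempty) (hcl : IsClosed X) (hcv : Convex ℝ X)
    (hb : Continuous b) (x : X) :
    reflectionCouplingKernel X hX b γ (x, x) (diagonal X) = 1 := by
  rw [← lintegral_indicator_one measurableSet_diagonal,
    lintegral_reflectionCouplingKernel hX hcl hcv hb x x
      (measurable_one.indicator measurableSet_diagonal)]
  simp [reflectionStep_of_eq]

lemma lintegral_unitInterval_ite {p : ℝ} (hp0 : 0 ≤ p) (hp1 : p ≤ 1) (A B : ℝ≥0∞) :
    ∫⁻ u : unitInterval, (if (u : ℝ) ≤ p then A else B)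
      = ENNReal.ofReal p * A + ENNReal.ofReal (1 - p) * B := by
  have h (u : unitInterval) : (if (u : ℝ) ≤ p then A else B)
      = (Iic (⟨p, hp0, hp1⟩ : unitInterval)).indicator (fun _ ↦ A) u
        + (Ioi (⟨p, hp0, hp1⟩ : unitInterval)).indicator (fun _ ↦ B) u := by
    by_cases hu : (u : ℝ) ≤ p
    · have h1 : u ≤ (⟨p, hp0, hp1⟩ : unitInterval) := hu
      simp [hu, h1]
    · have h1 : ¬ u ≤ (⟨p, hp0, hp1⟩ : unitInterval) := hu
      simp [hu, not_le.1 h1]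
  simp_rw [h]
  rw [lintegral_add_left (measurable_const.indicator measurableSet_Iic),
    lintegral_indicator_const measurableSet_Iic, lintegral_indicator_const measurableSet_Ioi,
    unitInterval.volume_Iic, unitInterval.volume_Ioi, mul_comm A, mul_comm B]

/-- The law of one reflection step, in coordinates along and orthogonally to the direction `e`: the
component `s` along `e` is Gaussian, it is kept for both points with probability `overlapProb`, and
reversed for the second point otherwise. -/
lemma lintegral_reflectionStep (hγ : 0 < γ) {x y : Eucl d}
    (hxy : eulerMap b γ x ≠ eulerMap b γ y) {F : Eucl d × Eucl d → ℝ≥0∞} (hF : Measurable F) :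
    ∫⁻ z, (∫⁻ u : unitInterval, F (reflectionStep b γ x y z u)) ∂(stdGaussian (Eucl d))
      = ∫⁻ w, ∫⁻ s,
          (ENNReal.ofReal (overlapProb γ.toNNReal ‖eulerDiff b γ x y‖ s) *
            F (eulerMap b γ x + (s • eulerDir b γ x y
                + √γ • (w - inner ℝ (eulerDir b γ x y) w • eulerDir b γ x y)),
              eulerMap b γ x + (s • eulerDir b γ x y
                + √γ • (w - inner ℝ (eulerDir b γ x y) w • eulerDir b γ x y)))
          + ENNReal.ofReal (1 - overlapProb γ.toNNReal ‖eulerDiff b γ x y‖ s) *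
            F (eulerMap b γ x + (s • eulerDir b γ x y
                + √γ • (w - inner ℝ (eulerDir b γ x y) w • eulerDir b γ x y)),
              eulerMap b γ y + (-s • eulerDir b γ x y
                + √γ • (w - inner ℝ (eulerDir b γ x y) w • eulerDir b γ x y))))
        ∂(gaussianReal 0 γ.toNNReal) ∂(stdGaussian (Eucl d)) := by
  have hE : ‖eulerDiff b γ x y‖ ≠ 0 := by
    rw [eulerDiff, norm_ne_zero_iff, sub_ne_zero]; exact hxy.symm
  have he : ‖eulerDir b γ x y‖ = 1 := by
    rw [eulerDir, norm_smul, norm_inv, norm_norm, inv_mul_cancel₀ hE]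
  have hv : (γ.toNNReal : ℝ) = √γ ^ 2 := by
    rw [Real.sq_sqrt hγ.le, Real.coe_toNNReal _ hγ.le]
  set e := eulerDir b γ x y with hedef
  set a := ‖eulerDiff b γ x y‖ with hadef
  have hp (z : Eucl d) : couplingProb b γ x y z = overlapProb γ.toNNReal a (inner ℝ e z) := rfl
  have hstep (z : Eucl d) (u : unitInterval) : F (reflectionStep b γ x y z u)
      = if (u : ℝ) ≤ overlapProb γ.toNNReal a (inner ℝ e (√γ • z))
        then F (eulerMap b γ x + √γ • z, eulerMap b γ x + √γ • z)
        else F (eulerMap b γ x + √γ • z, reflectedMove b γ x y (√γ • z)) := by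
    rw [reflectionStep, if_neg hxy, hp]
    split_ifs <;> rfl
  simp_rw [hstep, lintegral_unitInterval_ite (overlapProb_nonneg _ _) (overlapProb_le_one _ _)]
  have hmove : Measurable fun z ↦ reflectedMove b γ x y z := by unfold reflectedMove; fun_prop
  rw [lintegral_stdGaussian_smul he (√γ) hv (F := fun z ↦
    ENNReal.ofReal (overlapProb γ.toNNReal a (inner ℝ e z)) *
      F (eulerMap b γ x + z, eulerMap b γ x + z) +
    ENNReal.ofReal (1 - overlapProb γ.toNNReal a (inner ℝ e z)) *
      F (eulerMap b γ x + z, reflectedMove b γ x y z)) (by fun_prop)]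
  have hinner (s : ℝ) (w : Eucl d) : inner ℝ e (s • e + √γ • (w - inner ℝ e w • e)) = s := by
    simp only [inner_add_right, inner_sub_right, inner_smul_right, real_inner_self_eq_norm_sq, he]
    ring
  have hrefl (s : ℝ) (w : Eucl d) :
      reflectedMove b γ x y (s • e + √γ • (w - inner ℝ e w • e))
        = eulerMap b γ y + (-s • e + √γ • (w - inner ℝ e w • e)) := by
    rw [reflectedMove, ← hedef, hinner]
    congr 1
    module
  simp_rw [hinner, hrefl]

/-- The second point of the reflection step is distributed as the Euler move from `y`. -/
lemma lintegral_reflectionStep_snd (hγ : 0 < γ) (x y : Eucl d)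
    {f : Eucl d → ℝ≥0∞} (hf : Measurable f) :
    ∫⁻ z, (∫⁻ u : unitInterval, f (reflectionStep b γ x y z u).2) ∂(stdGaussian (Eucl d))
      = ∫⁻ z, f (eulerMap b γ y + √γ • z) ∂(stdGaussian (Eucl d)) := by
  by_cases hxy : eulerMap b γ x = eulerMap b γ y
  · simp [reflectionStep_of_eq hxy, hxy]
  have hE : ‖eulerDiff b γ x y‖ ≠ 0 := by
    rw [eulerDiff, norm_ne_zero_iff, sub_ne_zero]; exact Ne.symm hxy
  have he : ‖eulerDir b γ x y‖ = 1 := by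
    rw [eulerDir, norm_smul, norm_inv, norm_norm, inv_mul_cancel₀ hE]
  have hTx : eulerMap b γ x = eulerMap b γ y - ‖eulerDiff b γ x y‖ • eulerDir b γ x y := by
    rw [eulerDir, smul_smul, mul_inv_cancel₀ hE, one_smul, eulerDiff]; abel
  have hv : (γ.toNNReal : ℝ) = √γ ^ 2 := by
    rw [Real.sq_sqrt hγ.le, Real.coe_toNNReal _ hγ.le]
  have hv0 : γ.toNNReal ≠ 0 := by simpa using hγ
  rw [lintegral_reflectionStep hγ hxy (F := fun q ↦ f q.2) (by fun_prop),
    lintegral_stdGaussian_smul he (√γ) hv (F := fun z ↦ f (eulerMap b γ y + z)) (by fun_prop)]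
  refine lintegral_congr fun w ↦ ?_
  set e := eulerDir b γ x y
  set a := ‖eulerDiff b γ x y‖
  set r := √γ • (w - inner ℝ e w • e)
  dsimp only
  rw [lintegral_add_left (by fun_prop), lintegral_overlapProb_mul hv0 a (H := fun s ↦
    f (eulerMap b γ x + (s • e + r))) (by fun_prop), ← lintegral_add_left (by fun_prop),
    ← lintegral_gaussianReal_neg (fun s ↦ f (eulerMap b γ y + (s • e + r)))]
  refine lintegral_congr fun s ↦ ?_
  have h1 : eulerMap b γ x + ((a - s) • e + r) = eulerMap b γ y + (-s • e + r) := by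
    rw [hTx]; module
  rw [h1, ← add_mul, ← ENNReal.ofReal_add (overlapProb_nonneg _ _)
    (sub_nonneg.2 (overlapProb_le_one _ _))]
  simp

lemma isMarkovCoupling_reflectionCouplingKernel (hX : X.Nonempty) (hcl : IsClosed X)
    (hcv : Convex ℝ X) (hb : Continuous b) (hγ : 0 < γ) :
    IsMarkovCoupling (projEulerKernel X hX b γ) (reflectionCouplingKernel X hX b γ) := by
  refine ⟨isMarkovKernel_projEulerKernel hX hcl hcv hb,
    isMarkovKernel_reflectionCouplingKernel hX hcl hcv hb, fun x y ↦ ⟨?_, ?_⟩⟩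
  · refine Measure.ext_of_lintegral _ fun f hf ↦ ?_
    rw [lintegral_map hf measurable_fst, lintegral_projEulerKernel hX hcl hcv hb x hf,
      lintegral_reflectionCouplingKernel hX hcl hcv hb x y (f := fun q ↦ f q.1)
        (hf.comp measurable_fst)]
    simp [reflectionStep]
  · refine Measure.ext_of_lintegral _ fun f hf ↦ ?_
    rw [lintegral_map hf measurable_snd, lintegral_projEulerKernel hX hcl hcv hb y hf,
      lintegral_reflectionCouplingKernel hX hcl hcv hb x y (f := fun q ↦ f q.2)
        (hf.comp measurable_snd)]
    exact lintegral_reflectionStep_snd (b := b) hγ x y (f := fun u ↦ f (projOnto X hX u))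
      (hf.comp (measurable_projOnto hX hcl hcv))

/-- One step of the coupling turns the profile of variance `v` of the distance into the profile of
variance `v + γ` of the distance of the drifted points. -/
lemma lintegral_signMean_le (hX : X.Nonempty) (hcl : IsClosed X) (hcv : Convex ℝ X)
    (hb : Continuous b) (hγ : 0 < γ) (v : NNReal) (x y : X) :
    ∫⁻ q, ENNReal.ofReal (signMean v ‖(q.1 : Eucl d) - q.2‖)
        ∂(reflectionCouplingKernel X hX b γ (x, y))
      ≤ ENNReal.ofReal (signMean (v + γ.toNNReal) ‖eulerDiff b γ x y‖) := by
  rw [lintegral_reflectionCouplingKernel hX hcl hcv hb x y (by fun_prop)]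
  calc _ ≤ ∫⁻ z, (∫⁻ u : unitInterval, ENNReal.ofReal (signMean v
          ‖(reflectionStep b γ x y z u).1 - (reflectionStep b γ x y z u).2‖))
            ∂(stdGaussian (Eucl d)) := by
        refine lintegral_mono fun z ↦ lintegral_mono fun u ↦ ENNReal.ofReal_le_ofReal ?_
        exact monotone_signMean (norm_projOnto_sub_projOnto_le hX hcl hcv _ _)
    _ ≤ _ := ?_
  by_cases hxy : eulerMap b γ x = eulerMap b γ y
  · simp [reflectionStep_of_eq hxy, signMean_zero]
  have hE : ‖eulerDiff b γ (x : Eucl d) y‖ ≠ 0 := by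
    rw [eulerDiff, norm_ne_zero_iff, sub_ne_zero]; exact Ne.symm hxy
  have he : ‖eulerDir b γ (x : Eucl d) y‖ = 1 := by
    rw [eulerDir, norm_smul, norm_inv, norm_norm, inv_mul_cancel₀ hE]
  have hTx : eulerMap b γ (x : Eucl d)
      = eulerMap b γ y - ‖eulerDiff b γ (x : Eucl d) y‖ • eulerDir b γ (x : Eucl d) y := by
    rw [eulerDir, smul_smul, mul_inv_cancel₀ hE, one_smul, eulerDiff]; abel
  have hv0 : γ.toNNReal ≠ 0 := by simpa using hγ
  rw [lintegral_reflectionStep hγ hxy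
    (F := fun q ↦ ENNReal.ofReal (signMean v ‖q.1 - q.2‖)) (by fun_prop)]
  set e := eulerDir b γ (x : Eucl d) y
  set a := ‖eulerDiff b γ (x : Eucl d) y‖
  have hdist (s : ℝ) (r : Eucl d) :
      ‖eulerMap b γ (x : Eucl d) + (s • e + r) - (eulerMap b γ y + (-s • e + r))‖
        = |a - 2 * s| := by
    have : eulerMap b γ (x : Eucl d) + (s • e + r) - (eulerMap b γ y + (-s • e + r))
        = (2 * s - a) • e := by rw [hTx]; module
    rw [this, norm_smul, he, mul_one, Real.norm_eq_abs, abs_sub_comm]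
  simp only [hdist, sub_self, norm_zero, signMean_zero, ENNReal.ofReal_zero, mul_zero, zero_add]
  rw [lintegral_overlapProb_signMean hv0 (norm_nonneg _), lintegral_const, measure_univ, mul_one]

end SchemeKernels

/-! ### The drift condition -/

section Drift

variable {d : ℕ}

lemma integral_inner_stdGaussian (c : Eucl d) :
    ∫ z, inner ℝ c z ∂(stdGaussian (Eucl d)) = 0 :=
  integral_strongDual_stdGaussian (innerSL ℝ c)

lemma integrable_norm_sq_stdGaussian :
    Integrable (fun z ↦ ‖z‖ ^ 2) (stdGaussian (Eucl d)) :=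
  (IsGaussian.memLp_two_id (μ := stdGaussian (Eucl d))).integrable_norm_pow two_ne_zero

lemma integrable_inner_stdGaussian (c : Eucl d) :
    Integrable (fun z ↦ inner ℝ c z) (stdGaussian (Eucl d)) :=
  (innerSL ℝ c).integrable_comp IsGaussian.integrable_id

lemma integral_norm_sq_stdGaussian :
    ∫ z, ‖z‖ ^ 2 ∂(stdGaussian (Eucl d)) = d := by
  have hL (i : Fin d) : ∫ z : Eucl d, z i ^ 2 ∂(stdGaussian (Eucl d)) = 1 := by
    have h := variance_dual_stdGaussian (E := Eucl d)
      (innerSL ℝ (EuclideanSpace.single i (1 : ℝ)))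
    rw [variance_of_integral_eq_zero (by fun_prop) (integral_strongDual_stdGaussian _)] at h
    simpa [EuclideanSpace.inner_single_left] using h
  have hi (i : Fin d) : Integrable (fun z : Eucl d ↦ z i ^ 2) (stdGaussian (Eucl d)) := by
    refine integrable_norm_sq_stdGaussian.mono' (by fun_prop)
      (Filter.Eventually.of_forall fun z ↦ ?_)
    rw [Real.norm_of_nonneg (sq_nonneg _), EuclideanSpace.real_norm_sq_eq]
    exact Finset.single_le_sum (f := fun j ↦ z j ^ 2) (fun j _ ↦ sq_nonneg _) (Finset.mem_univ i)
  simp_rw [EuclideanSpace.real_norm_sq_eq]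
  rw [integral_finsetSum _ fun i _ ↦ hi i]
  simp [hL]

lemma lintegral_one_add_norm_sq (c : Eucl d) {γ : ℝ} (hγ : 0 ≤ γ) :
    ∫⁻ z, ENNReal.ofReal (1 + ‖c + √γ • z‖ ^ 2) ∂(stdGaussian (Eucl d))
      = ENNReal.ofReal (1 + ‖c‖ ^ 2 + γ * d) := by
  have h (z : Eucl d) : 1 + ‖c + √γ • z‖ ^ 2
      = (1 + ‖c‖ ^ 2) + 2 * √γ * inner ℝ c z + γ * ‖z‖ ^ 2 := by
    rw [norm_add_sq_real, norm_smul, inner_smul_right, mul_pow, Real.norm_eq_abs, sq_abs,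
      Real.sq_sqrt hγ]
    ring
  have h1 : Integrable (fun z : Eucl d ↦ (1 + ‖c‖ ^ 2) + 2 * √γ * inner ℝ c z)
      (stdGaussian (Eucl d)) :=
    (integrable_const _).add ((integrable_inner_stdGaussian c).const_mul _)
  have h2 : Integrable (fun z : Eucl d ↦ γ * ‖z‖ ^ 2) (stdGaussian (Eucl d)) :=
    integrable_norm_sq_stdGaussian.const_mul _
  rw [← ofReal_integral_eq_lintegral_ofReal]
  · simp_rw [h]
    rw [integral_add h1 h2, integral_add (integrable_const _)
      ((integrable_inner_stdGaussian c).const_mul _), integral_const_mul, integral_const_mul,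
      integral_inner_stdGaussian, integral_norm_sq_stdGaussian]
    simp
  · simp_rw [h]; exact h1.add h2
  · exact Filter.Eventually.of_forall fun z ↦ by positivity

variable {X : Set (Eucl d)} {b : Eucl d → Eucl d} {L R₂ m₂ m γ γbar : ℝ}

/-- Dissipativity outside of the ball of radius `R₂` and one-sided Lipschitz continuity inside. -/
lemma norm_eulerMap_sq_le (h0 : (0 : Eucl d) ∈ X)
    (hbLip : ∀ x ∈ X, ∀ y ∈ X, ‖b x - b y‖ ≤ L * ‖x - y‖) (hb0 : b 0 = 0)
    (hm₂ : 0 < m₂) (hm : m ≤ 0)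
    (hdiss : ∀ x ∈ X, R₂ < ‖x‖ → inner ℝ (b x) x ≤ -m₂ * ‖x‖ ^ 2)
    (hone : ∀ x ∈ X, ∀ y ∈ X, inner ℝ (b x - b y) (x - y) ≤ -m * ‖x - y‖ ^ 2)
    (hγ : 0 ≤ γ) {x : Eucl d} (hx : x ∈ X) :
    ‖eulerMap b γ x‖ ^ 2
      ≤ (1 - 2 * γ * m₂ + γ ^ 2 * L ^ 2) * ‖x‖ ^ 2 + γ * (2 * R₂ ^ 2 * (m₂ - m)) := by
  have hbx : ‖b x‖ ^ 2 ≤ L ^ 2 * ‖x‖ ^ 2 := by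
    have h := hbLip x hx 0 h0
    rw [hb0, sub_zero, sub_zero] at h
    calc ‖b x‖ ^ 2 ≤ (L * ‖x‖) ^ 2 := by gcongr
      _ = _ := by ring
  have hin : inner ℝ (b x) x ≤ -m₂ * ‖x‖ ^ 2 + R₂ ^ 2 * (m₂ - m) := by
    by_cases hR : R₂ < ‖x‖
    · have : 0 ≤ R₂ ^ 2 * (m₂ - m) := mul_nonneg (sq_nonneg _) (by linarith)
      linarith [hdiss x hx hR]
    · have h := hone x hx 0 h0
      rw [hb0, sub_zero, sub_zero] at h
      have h2 : ‖x‖ ^ 2 ≤ R₂ ^ 2 := by gcongr; exact not_lt.1 hR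
      nlinarith
  have hexp : ‖eulerMap b γ x‖ ^ 2 = ‖x‖ ^ 2 + 2 * γ * inner ℝ (b x) x + γ ^ 2 * ‖b x‖ ^ 2 := by
    rw [eulerMap, norm_add_sq_real, norm_smul, inner_smul_right, mul_pow, Real.norm_eq_abs, sq_abs,
      real_inner_comm]
    ring
  rw [hexp]
  nlinarith [mul_le_mul_of_nonneg_left hin hγ, mul_le_mul_of_nonneg_left hbx (sq_nonneg γ)]

lemma contraction_le_driftLam_rpow (hγ : γ ∈ Ioc 0 γbar) :
    1 - 2 * γ * m₂ + γ ^ 2 * L ^ 2 ≤ (driftLam m₂ L γbar ^ γ) ^ 2 := by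
  rw [driftLam, ← Real.exp_mul, ← Real.exp_nat_mul]
  refine le_trans ?_ (Real.add_one_le_exp _)
  have h : γ ^ 2 * L ^ 2 ≤ γ * γbar * L ^ 2 := by
    rw [sq γ]
    gcongr
    · exact hγ.1.le
    · exact hγ.2
  push_cast
  linarith

@[fun_prop]
lemma measurable_quadLyapunov : Measurable (quadLyapunov X) := by
  unfold quadLyapunov; fun_prop

lemma lintegral_quadLyapunov_le (hX : X.Nonempty) (hcl : IsClosed X) (hcv : Convex ℝ X)
    (hb : Continuous b) (h0 : (0 : Eucl d) ∈ X)
    (hbLip : ∀ x ∈ X, ∀ y ∈ X, ‖b x - b y‖ ≤ L * ‖x - y‖) (hb0 : b 0 = 0)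
    (hm₂ : 0 < m₂) (hm : m ≤ 0)
    (hdiss : ∀ x ∈ X, R₂ < ‖x‖ → inner ℝ (b x) x ≤ -m₂ * ‖x‖ ^ 2)
    (hone : ∀ x ∈ X, ∀ y ∈ X, inner ℝ (b x - b y) (x - y) ≤ -m * ‖x - y‖ ^ 2)
    (hγ : γ ∈ Ioc 0 γbar) (x : X) :
    ∫⁻ q, ENNReal.ofReal (quadLyapunov X q) ∂(projEulerKernel X hX b γ x)
      ≤ ENNReal.ofReal ((driftLam m₂ L γbar ^ γ) ^ 2 * quadLyapunov X x
          + driftA d R₂ m₂ m * γ) := by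
  rw [lintegral_projEulerKernel hX hcl hcv hb x (by fun_prop)]
  calc _ ≤ ∫⁻ z, ENNReal.ofReal (1 + ‖eulerMap b γ (x : Eucl d) + √γ • z‖ ^ 2)
          ∂(stdGaussian (Eucl d)) := by
        refine lintegral_mono fun z ↦ ENNReal.ofReal_le_ofReal ?_
        rw [quadLyapunov]
        gcongr
        exact norm_projOnto_le hX hcl hcv h0 _
    _ = ENNReal.ofReal (1 + ‖eulerMap b γ (x : Eucl d)‖ ^ 2 + γ * d) :=
        lintegral_one_add_norm_sq _ hγ.1.le
    _ ≤ _ := by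
        refine ENNReal.ofReal_le_ofReal ?_
        have h1 := norm_eulerMap_sq_le h0 hbLip hb0 hm₂ hm hdiss hone hγ.1.le x.2
        have h2 := contraction_le_driftLam_rpow (m₂ := m₂) (L := L) hγ
        have h3 := mul_le_mul_of_nonneg_right h2 (by positivity : 0 ≤ 1 + ‖(x : Eucl d)‖ ^ 2)
        have h4 : 0 ≤ γ ^ 2 * L ^ 2 := by positivity
        rw [driftA, quadLyapunov]
        nlinarith

lemma quadLyapunovPair_eq (x y : X) :
    quadLyapunovPair X (x, y) = (quadLyapunov X x + quadLyapunov X y) / 2 := by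
  rw [quadLyapunovPair, quadLyapunov, quadLyapunov]; ring

lemma measurable_quadLyapunovPair : Measurable (quadLyapunovPair X) := by
  unfold quadLyapunovPair; fun_prop

lemma one_le_quadLyapunovPair (p : X × X) : 1 ≤ quadLyapunovPair X p := by
  rw [quadLyapunovPair]; have : 0 ≤ ‖(p.1 : Eucl d)‖ ^ 2 / 2 + ‖(p.2 : Eucl d)‖ ^ 2 / 2 := by
    positivity
  linarith

/-- Outside of the product of balls of radius `driftRadius`, half of the contraction absorbs the
additive term. -/
lemma sq_rpow_mul_add_le {lam A v : ℝ} (hl : 0 < lam) (hl1 : lam < 1) (hA : 0 ≤ A)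
    (hγ : γ ∈ Ioc 0 γbar) (hv : driftRadius lam A γbar ^ 2 / 2 ≤ v) :
    (lam ^ γ) ^ 2 * v + A * γ ≤ lam ^ γ * v := by
  have hlog : 0 < Real.log (1 / lam) := Real.log_pos (by rw [lt_div_iff₀ hl]; linarith)
  have hR : driftRadius lam A γbar ^ 2 / 2
      = (lam ^ (-γbar)) ^ 2 * A * (Real.log (1 / lam))⁻¹ := by
    rw [driftRadius, mul_pow, mul_pow, mul_pow, inv_pow, Real.sq_sqrt hA, Real.sq_sqrt hlog.le,
      Real.sq_sqrt (by norm_num)]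
    ring
  rw [hR] at hv
  have h1 := mul_log_inv_mul_rpow_le (s := γ) hl
  have h2 : 0 < lam ^ γ := Real.rpow_pos_of_pos hl _
  have h3 : 1 ≤ lam ^ γ * lam ^ (-γbar) := by
    rw [← Real.rpow_add hl]
    exact Real.one_le_rpow_of_pos_of_le_one_of_nonpos hl hl1.le (by linarith [hγ.2])
  have hγ0 := hγ.1
  have hv0 : 0 ≤ v := le_trans (by positivity) hv
  have h4 : A * γ ≤ lam ^ γ * (γ * Real.log (1 / lam) * lam ^ γ) * v := by
    calc A * γ = 1 ^ 2 * (A * γ) := by ring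
      _ ≤ (lam ^ γ * lam ^ (-γbar)) ^ 2 * (A * γ) := by gcongr
      _ = lam ^ γ * (γ * Real.log (1 / lam) * lam ^ γ) *
          ((lam ^ (-γbar)) ^ 2 * A * (Real.log (1 / lam))⁻¹) := by field_simp
      _ ≤ _ := by gcongr
  have h5 : lam ^ γ * (γ * Real.log (1 / lam) * lam ^ γ) * v ≤ lam ^ γ * (1 - lam ^ γ) * v := by
    gcongr
  linarith

lemma driftCondition_reflectionCouplingKernel (hX : X.Nonempty) (hcl : IsClosed X)
    (hcv : Convex ℝ X) (hb : Continuous b) (h0 : (0 : Eucl d) ∈ X)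
    (hbLip : ∀ x ∈ X, ∀ y ∈ X, ‖b x - b y‖ ≤ L * ‖x - y‖) (hb0 : b 0 = 0)
    (hm₂ : 0 < m₂) (hm : m ≤ 0)
    (hdiss : ∀ x ∈ X, R₂ < ‖x‖ → inner ℝ (b x) x ≤ -m₂ * ‖x‖ ^ 2)
    (hone : ∀ x ∈ X, ∀ y ∈ X, inner ℝ (b x - b y) (x - y) ≤ -m * ‖x - y‖ ^ 2)
    (hl1 : driftLam m₂ L γbar < 1) (hA : 0 ≤ driftA d R₂ m₂ m) (hγ : γ ∈ Ioc 0 γbar) :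
    DriftCondition (reflectionCouplingKernel X hX b γ) (quadLyapunovPair X)
      (driftLam m₂ L γbar ^ γ) (driftA d R₂ m₂ m * γ)
      (ballPair X (driftRadius (driftLam m₂ L γbar) (driftA d R₂ m₂ m) γbar)) := by
  rintro ⟨x, y⟩
  have hl : 0 < driftLam m₂ L γbar := Real.exp_pos _
  have hβ : 0 < driftLam m₂ L γbar ^ γ := Real.rpow_pos_of_pos hl _
  have hβ1 : driftLam m₂ L γbar ^ γ ≤ 1 := Real.rpow_le_one hl.le hl1.le hγ.1.le
  obtain ⟨-, -, hc⟩ := isMarkovCoupling_reflectionCouplingKernel (γ := γ) hX hcl hcv hb hγ.1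
  have hq0 (z : X) : 0 ≤ quadLyapunov X z := by rw [quadLyapunov]; positivity
  have hqm : Measurable fun z ↦ ENNReal.ofReal (quadLyapunov X z) := by fun_prop
  have hsplit (p : X × X) : ENNReal.ofReal (quadLyapunovPair X p)
      = ENNReal.ofReal 2⁻¹ * (ENNReal.ofReal (quadLyapunov X p.1)
        + ENNReal.ofReal (quadLyapunov X p.2)) := by
    rw [← ENNReal.ofReal_add (hq0 _) (hq0 _), ← ENNReal.ofReal_mul (by norm_num),
      show p = (p.1, p.2) from rfl, quadLyapunovPair_eq]
    congr 1; ring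
  have hx := lintegral_quadLyapunov_le hX hcl hcv hb h0 hbLip hb0 hm₂ hm hdiss hone hγ x
  have hy := lintegral_quadLyapunov_le hX hcl hcv hb h0 hbLip hb0 hm₂ hm hdiss hone hγ y
  rw [← (hc x y).1, lintegral_map hqm measurable_fst] at hx
  rw [← (hc x y).2, lintegral_map hqm measurable_snd] at hy
  simp_rw [hsplit]
  rw [lintegral_const_mul _ (by fun_prop), lintegral_add_left (by fun_prop)]
  set β := driftLam m₂ L γbar ^ γ
  set A := driftA d R₂ m₂ m
  have hγ0 := hγ.1
  have hqx := hq0 x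
  have hqy := hq0 y
  calc _ ≤ ENNReal.ofReal 2⁻¹ * (ENNReal.ofReal (β ^ 2 * quadLyapunov X x + A * γ)
        + ENNReal.ofReal (β ^ 2 * quadLyapunov X y + A * γ)) := by gcongr
    _ = ENNReal.ofReal (β ^ 2 * quadLyapunovPair X (x, y) + A * γ) := by
        rw [← ENNReal.ofReal_add (by positivity) (by positivity),
          ← ENNReal.ofReal_mul (by norm_num), quadLyapunovPair_eq]
        congr 1; ring
    _ ≤ _ := by
        refine ENNReal.ofReal_le_ofReal ?_
        have hv := one_le_quadLyapunovPair (x, y)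
        by_cases hC : (x, y) ∈ ballPair X (driftRadius (driftLam m₂ L γbar) A γbar)
        · rw [indicator_of_mem hC]
          have : β ^ 2 ≤ β := by nlinarith
          gcongr
        · rw [indicator_of_notMem hC, add_zero]
          refine sq_rpow_mul_add_le hl hl1 hA hγ ?_
          have hR0 : 0 ≤ driftRadius (driftLam m₂ L γbar) A γbar := by
            rw [driftRadius]; positivity
          rw [quadLyapunovPair]
          have h1 := sq_nonneg ‖(x : Eucl d)‖
          have h2 := sq_nonneg ‖(y : Eucl d)‖
          rw [ballPair, mem_ofPred_eq, not_and_or, not_le, not_le] at hC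
          rcases hC with hC | hC
          · have := pow_le_pow_left₀ hR0 hC.le 2
            dsimp only at *; linarith
          · have := pow_le_pow_left₀ hR0 hC.le 2
            dsimp only at *; linarith

end Drift

/-! ### The minorization condition -/

section Minorization

variable {d : ℕ} {X : Set (Eucl d)} {b : Eucl d → Eucl d} {γ g : ℝ}

/-- The variance accumulated after `n` steps by the reflected components, seen from the initial
distance, when the squared distance grows at most by the factor `g` at each step. -/
noncomputable def accumulatedVar (γ g : ℝ) (n : ℕ) : ℝ := γ * ∑ k ∈ Finset.Icc 1 n, (g ^ k)⁻¹

lemma accumulatedVar_nonneg (hγ : 0 ≤ γ) (hg : 0 ≤ g) (n : ℕ) : 0 ≤ accumulatedVar γ g n :=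
  mul_nonneg hγ (Finset.sum_nonneg fun _ _ ↦ by positivity)

lemma mul_accumulatedVar_succ (hg : g ≠ 0) (n : ℕ) :
    g * accumulatedVar γ g (n + 1) = accumulatedVar γ g n + γ := by
  induction n with
  | zero => simp [accumulatedVar]; field_simp
  | succ n ih =>
    have h (n : ℕ) : accumulatedVar γ g (n + 1) = accumulatedVar γ g n + γ * (g ^ (n + 1))⁻¹ := by
      rw [accumulatedVar, Finset.sum_Icc_succ_top (by omega), mul_add, ← accumulatedVar]
    rw [h (n + 1), mul_add, ih, h n, pow_succ g (n + 1)]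
    field_simp
    ring

lemma le_accumulatedVar (hγ : 0 ≤ γ) (hg : 1 ≤ g) (n : ℕ) :
    γ * n * (g ^ n)⁻¹ ≤ accumulatedVar γ g n := by
  rw [accumulatedVar, mul_assoc]
  gcongr
  calc (n : ℝ) * (g ^ n)⁻¹ = ∑ k ∈ Finset.Icc 1 n, (g ^ n)⁻¹ := by simp
    _ ≤ _ := by
      refine Finset.sum_le_sum fun k hk ↦ ?_
      have : g ^ k ≤ g ^ n := pow_le_pow_right₀ hg (Finset.mem_Icc.1 hk).2
      gcongr

lemma pow_reflectionCouplingKernel_compl_le (hX : X.Nonempty) (hcl : IsClosed X)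
    (hcv : Convex ℝ X) (hb : Continuous b) (hγ : 0 < γ) (hg : 1 ≤ g)
    (hexp : ∀ x ∈ X, ∀ y ∈ X, ‖eulerDiff b γ x y‖ ^ 2 ≤ g * ‖x - y‖ ^ 2) (n : ℕ) (x y : X) :
    (reflectionCouplingKernel X hX b γ ^ n) (x, y) (diagonal X)ᶜ
      ≤ ENNReal.ofReal (signMean (accumulatedVar γ g n).toNNReal ‖(x : Eucl d) - y‖) := by
  have hg0 : 0 < g := by linarith
  induction n generalizing x y with
  | zero =>
    rw [pow_zero, show (1 : Kernel (X × X) (X × X)) = Kernel.id from rfl, Kernel.id_apply,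
      Measure.dirac_apply' _ measurableSet_diagonal.compl]
    by_cases hxy : x = y
    · simp [hxy]
    · have : 0 < ‖(x : Eucl d) - y‖ := by
        rw [norm_pos_iff, sub_ne_zero]; exact fun h ↦ hxy (Subtype.ext h)
      simp [hxy, accumulatedVar, signMean_zero_var, Real.sign_of_pos this]
  | succ n ih =>
    have hvn := accumulatedVar_nonneg hγ.le hg0.le n
    have hscale : signMean ((accumulatedVar γ g n).toNNReal + γ.toNNReal)
        (√g * ‖(x : Eucl d) - y‖)
        = signMean (accumulatedVar γ g (n + 1)).toNNReal ‖(x : Eucl d) - y‖ := by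
      refine signMean_scale (Real.sqrt_pos.2 hg0) ?_ _
      rw [Real.sq_sqrt hg0.le, NNReal.coe_add, Real.coe_toNNReal _ hvn, Real.coe_toNNReal _ hγ.le,
        Real.coe_toNNReal _ (accumulatedVar_nonneg hγ.le hg0.le _),
        mul_accumulatedVar_succ hg0.ne']
    have hE : ‖eulerDiff b γ (x : Eucl d) y‖ ≤ √g * ‖(x : Eucl d) - y‖ := by
      refine (abs_le_of_sq_le_sq' ?_ (by positivity)).2
      rw [mul_pow, Real.sq_sqrt hg0.le]
      exact hexp x x.2 y y.2
    rw [add_comm, Kernel.pow_add_apply_eq_lintegral _ _ _ _ measurableSet_diagonal.compl, pow_one]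
    calc _ ≤ ∫⁻ q, ENNReal.ofReal (signMean (accumulatedVar γ g n).toNNReal
            ‖(q.1 : Eucl d) - q.2‖) ∂(reflectionCouplingKernel X hX b γ (x, y)) :=
          lintegral_mono fun q ↦ ih q.1 q.2
      _ ≤ ENNReal.ofReal (signMean ((accumulatedVar γ g n).toNNReal + γ.toNNReal)
            ‖eulerDiff b γ (x : Eucl d) y‖) := lintegral_signMean_le hX hcl hcv hb hγ _ x y
      _ ≤ ENNReal.ofReal (signMean ((accumulatedVar γ g n).toNNReal + γ.toNNReal)
            (√g * ‖(x : Eucl d) - y‖)) := ENNReal.ofReal_le_ofReal (monotone_signMean hE)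
      _ = _ := by rw [hscale, add_comm n 1]

/-- The Gaussian form of the bound on the probability that the two chains have not met. -/
lemma pow_reflectionCouplingKernel_compl_le_cdf (hX : X.Nonempty) (hcl : IsClosed X)
    (hcv : Convex ℝ X) (hb : Continuous b) (hγ : 0 < γ) (hg : 1 ≤ g)
    (hexp : ∀ x ∈ X, ∀ y ∈ X, ‖eulerDiff b γ x y‖ ^ 2 ≤ g * ‖x - y‖ ^ 2) {n : ℕ} (hn : 1 ≤ n)
    (x y : X) :
    (reflectionCouplingKernel X hX b γ ^ n) (x, y) (diagonal X)ᶜ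
      ≤ ENNReal.ofReal (1 - 2 * stdNormalCdf
        (-(‖(x : Eucl d) - y‖ / (2 * √(accumulatedVar γ g n))))) := by
  have hg0 : 0 < g := by linarith
  have hv : 0 < accumulatedVar γ g n := by
    refine lt_of_lt_of_le ?_ (le_accumulatedVar hγ.le hg n)
    have : (0 : ℝ) < n := by exact_mod_cast hn
    positivity
  refine (pow_reflectionCouplingKernel_compl_le hX hcl hcv hb hγ hg hexp n x y).trans_eq ?_
  rw [signMean_eq (by simpa using hv), Real.coe_toNNReal _ hv.le]

lemma norm_eulerDiff_sq (x y : Eucl d) : ‖eulerDiff b γ x y‖ ^ 2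
    = ‖x - y‖ ^ 2 + 2 * γ * inner ℝ (b x - b y) (x - y) + γ ^ 2 * ‖b x - b y‖ ^ 2 := by
  have : eulerDiff b γ x y = -((x - y) + γ • (b x - b y)) := by
    rw [eulerDiff, eulerMap, eulerMap]; module
  rw [this, norm_neg, norm_add_sq_real, norm_smul, inner_smul_right, mul_pow, Real.norm_eq_abs,
    sq_abs, real_inner_comm]
  ring

lemma norm_eulerDiff_sq_le_of_oneSided {L m : ℝ} (hγ : 0 ≤ γ)
    (hbLip : ∀ x ∈ X, ∀ y ∈ X, ‖b x - b y‖ ≤ L * ‖x - y‖)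
    (hone : ∀ x ∈ X, ∀ y ∈ X, inner ℝ (b x - b y) (x - y) ≤ -m * ‖x - y‖ ^ 2)
    {x y : Eucl d} (hx : x ∈ X) (hy : y ∈ X) :
    ‖eulerDiff b γ x y‖ ^ 2 ≤ (1 + γ * kappa m L γ) * ‖x - y‖ ^ 2 := by
  have h1 : ‖b x - b y‖ ^ 2 ≤ L ^ 2 * ‖x - y‖ ^ 2 := by
    rw [← mul_pow]; gcongr; exact hbLip x hx y hy
  rw [norm_eulerDiff_sq, kappa]
  nlinarith [mul_le_mul_of_nonneg_left (hone x hx y hy) hγ,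
    mul_le_mul_of_nonneg_left h1 (sq_nonneg γ)]

/-- Under co-coercivity the Euler map is nonexpansive for step sizes at most `2 * mb`. -/
lemma norm_eulerDiff_sq_le_of_coercive {mb : ℝ} (hγ : 0 ≤ γ) (hγmb : γ ≤ 2 * mb)
    (hco : ∀ x ∈ X, ∀ y ∈ X, inner ℝ (b x - b y) (x - y) ≤ -mb * ‖b x - b y‖ ^ 2)
    {x y : Eucl d} (hx : x ∈ X) (hy : y ∈ X) :
    ‖eulerDiff b γ x y‖ ^ 2 ≤ 1 * ‖x - y‖ ^ 2 := by
  have h1 := mul_le_mul_of_nonneg_left (hco x hx y hy) hγ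
  have h2 : 0 ≤ γ * (2 * mb - γ) * ‖b x - b y‖ ^ 2 :=
    mul_nonneg (mul_nonneg hγ (by linarith)) (sq_nonneg _)
  rw [norm_eulerDiff_sq]
  nlinarith

end Minorization

/-! ### The Gaussian lower bounds -/

section GaussianBounds

lemma monotone_stdNormalCdf : Monotone stdNormalCdf := monotone_cdf _

lemma stdNormalCdf_pos (t : ℝ) : 0 < stdNormalCdf t := by
  rw [stdNormalCdf, cdf_eq_real, measureReal_def, ENNReal.toReal_pos_iff]
  refine ⟨pos_iff_ne_zero.2 fun h ↦ ?_, measure_lt_top _ _⟩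
  have := gaussianReal_absolutelyContinuous' 0 one_ne_zero h
  simp at this

lemma two_mul_stdNormalCdf_neg {t : ℝ} : 2 * stdNormalCdf (-t) = 1 - signMean 1 (2 * t) := by
  rw [signMean_one, mul_div_cancel_left₀ _ two_ne_zero]; ring

lemma two_mul_stdNormalCdf_neg_mem {t : ℝ} (ht : 0 ≤ t) :
    2 * stdNormalCdf (-t) ∈ Icc (0 : ℝ) 1 := by
  refine ⟨by linarith [stdNormalCdf_pos (-t)], ?_⟩
  rw [two_mul_stdNormalCdf_neg]
  linarith [signMean_nonneg (v := 1) (t := 2 * t) (by linarith)]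

lemma two_mul_stdNormalCdf_neg_lt_one {t : ℝ} (ht : 0 < t) : 2 * stdNormalCdf (-t) < 1 := by
  have h0 : 2 * stdNormalCdf 0 = 1 := by
    have := two_mul_stdNormalCdf_neg (t := 0)
    rwa [mul_zero, signMean_zero, neg_zero, sub_zero] at this
  have h1 : stdNormalCdf (-t) < stdNormalCdf 0 := by
    rw [stdNormalCdf, stdNormalCdf, cdf_eq_real, cdf_eq_real, ← sub_pos,
      ← measureReal_sdiff (Iic_subset_Iic.2 (by linarith)) measurableSet_Iic, measureReal_def,
      ENNReal.toReal_pos_iff]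
    refine ⟨pos_iff_ne_zero.2 fun h ↦ ?_, measure_lt_top _ _⟩
    have := gaussianReal_absolutelyContinuous' 0 one_ne_zero h
    rw [Iic_sdiff_Iic, Real.volume_Ioc, ENNReal.ofReal_eq_zero] at this
    linarith
  linarith

variable {m L γ γbar M : ℝ} {ℓ ℓ₀ : ℕ} {t : ℝ}

lemma kappa_nonneg (hm : m ≤ 0) (hγ : 0 ≤ γ) : 0 ≤ kappa m L γ := by
  have : 0 ≤ L ^ 2 * γ := by positivity
  rw [kappa]; linarith

lemma one_le_one_add_mul_kappa (hm : m ≤ 0) (hγ : 0 ≤ γ) : 1 ≤ 1 + γ * kappa m L γ := by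
  have := mul_nonneg hγ (kappa_nonneg (L := L) hm hγ); linarith

/-- A lower bound on `Ξ` that is uniform in the step size. -/
lemma exp_le_bigXi (hm : m ≤ 0) (hγ : γ ∈ Ioc 0 γbar) :
    ℓ * Real.exp (-(kappa m L γbar * ((1 + γbar) * ℓ))) ≤ bigXi m L γ (ℓ * ⌈1 / γ⌉₊) := by
  have hγ0 := hγ.1
  set n := ℓ * ⌈1 / γ⌉₊ with hn
  have hκ := kappa_nonneg (L := L) hm hγ0.le
  have hκb : kappa m L γ ≤ kappa m L γbar := by
    rw [kappa, kappa]; gcongr; exact hγ.2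
  have hg : 0 < 1 + γ * kappa m L γ := by positivity
  refine le_trans ?_ (le_accumulatedVar hγ0.le (one_le_one_add_mul_kappa hm hγ0.le) n)
  have hpow : (1 + γ * kappa m L γ) ^ n ≤ Real.exp (kappa m L γbar * ((1 + γbar) * ℓ)) := by
    calc (1 + γ * kappa m L γ) ^ n ≤ (Real.exp (γ * kappa m L γ)) ^ n := by
          gcongr; linarith [Real.add_one_le_exp (γ * kappa m L γ)]
      _ = Real.exp (kappa m L γ * (γ * n)) := by rw [← Real.exp_nat_mul]; ring_nf
      _ ≤ _ := by
          have hnγ : γ * n ≤ (1 + γbar) * ℓ := mul_ceil_le hγ ℓ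
          gcongr
          exact hκ.trans hκb
  have hℓn : (ℓ : ℝ) ≤ γ * n := le_mul_ceil hγ0 ℓ
  rw [Real.exp_neg]
  gcongr

lemma bigXi_pos (hm : m ≤ 0) (hγ : 0 < γ) (hℓ : 1 ≤ ℓ) : 0 < bigXi m L γ (ℓ * ⌈1 / γ⌉₊) := by
  refine lt_of_lt_of_le ?_ (exp_le_bigXi (γbar := γ) hm ⟨hγ, le_rfl⟩)
  have : (0 : ℝ) < ℓ := by exact_mod_cast hℓ
  positivity

lemma psiMonotone_mem (ht : 0 ≤ t) : psiMonotone m L γ ℓ t ∈ Icc (0 : ℝ) 1 :=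
  two_mul_stdNormalCdf_neg_mem (by positivity)

lemma psiMonotone_lt_one (hm : m ≤ 0) (hγ : 0 < γ) (hℓ : 1 ≤ ℓ) (ht : 0 < t) :
    psiMonotone m L γ ℓ t < 1 := by
  have := Real.sqrt_pos.2 (bigXi_pos (L := L) hm hγ hℓ)
  exact two_mul_stdNormalCdf_neg_lt_one (by positivity)

lemma exists_pos_le_psiMonotone (hm : m ≤ 0) (hℓ : 1 ≤ ℓ) {M' : ℝ} :
    ∃ δ > 0, ∀ γ ∈ Ioc 0 γbar, ∀ t, 0 ≤ t → t ≤ M' → δ ≤ psiMonotone m L γ ℓ t := by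
  set ξ := (ℓ : ℝ) * Real.exp (-(kappa m L γbar * ((1 + γbar) * ℓ))) with hξ
  have hℓ0 : (0 : ℝ) < ℓ := by exact_mod_cast hℓ
  have hξ0 : 0 < ξ := by positivity
  refine ⟨2 * stdNormalCdf (-(M' / (2 * √ξ))), by linarith [stdNormalCdf_pos (-(M' / (2 * √ξ)))],
    fun γ hγ t ht htM ↦ ?_⟩
  have h1 : √ξ ≤ √(bigXi m L γ (ℓ * ⌈1 / γ⌉₊)) := Real.sqrt_le_sqrt (exp_le_bigXi hm hγ)
  have h2 : 0 < √ξ := Real.sqrt_pos.2 hξ0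
  rw [psiMonotone]
  refine mul_le_mul_of_nonneg_left (monotone_stdNormalCdf (neg_le_neg ?_)) (by norm_num)
  exact div_le_div₀ (ht.trans htM) htM (by positivity) (by linarith)

lemma psiCoercive_mem (ht : 0 ≤ t) : psiCoercive L M ℓ₀ γ ℓ t ∈ Icc (0 : ℝ) 1 := by
  rw [psiCoercive]
  split_ifs
  · exact two_mul_stdNormalCdf_neg_mem (by norm_num)
  · exact psiMonotone_mem ht

lemma psiCoercive_lt_one (hγ : 0 < γ) (hℓ : 1 ≤ ℓ) (ht : 0 < t) :
    psiCoercive L M ℓ₀ γ ℓ t < 1 := by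
  rw [psiCoercive]
  split_ifs
  · exact two_mul_stdNormalCdf_neg_lt_one (by norm_num)
  · exact psiMonotone_lt_one le_rfl hγ hℓ ht

lemma exists_pos_le_psiCoercive (hℓ : 1 ≤ ℓ) {M' : ℝ} :
    ∃ δ > 0, ∀ γ ∈ Ioc 0 γbar, ∀ t, 0 ≤ t → t ≤ M' → δ ≤ psiCoercive L M ℓ₀ γ ℓ t := by
  obtain ⟨δ, hδ, h⟩ := exists_pos_le_psiMonotone (γbar := γbar) (L := L) (m := 0) le_rfl hℓ
    (M' := M')
  refine ⟨min (2 * stdNormalCdf (-(1 / 2))) δ,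
    lt_min (by linarith [stdNormalCdf_pos (-(1 / 2))]) hδ, fun γ hγ t ht htM ↦ ?_⟩
  rw [psiCoercive]
  split_ifs
  · exact min_le_left _ _
  · exact (min_le_right _ _).trans (h γ hγ t ht htM)

end GaussianBounds

/-! ### Convergence of the projected scheme -/

section Conclusion

variable {d : ℕ} {X : Set (Eucl d)} {b : Eucl d → Eucl d} {L R₂ m₂ m γbar : ℝ}
  {Ψ : ℝ → ℕ → ℝ → ℝ}

/-- The drift estimate for a one-sided Lipschitz drift, combined with any minorization profile `Ψ`
that is bounded below uniformly in the step size. -/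
theorem convergenceFor_of_minorization (hd : 1 ≤ d) (hcl : IsClosed X) (hcv : Convex ℝ X)
    (h0 : (0 : Eucl d) ∈ X) (hb : Continuous b)
    (hbLip : ∀ x ∈ X, ∀ y ∈ X, ‖b x - b y‖ ≤ L * ‖x - y‖) (hb0 : b 0 = 0)
    (hm₂ : 0 < m₂) (hdiss : ∀ x ∈ X, R₂ < ‖x‖ → inner ℝ (b x) x ≤ -m₂ * ‖x‖ ^ 2)
    (hγpos : 0 < γbar) (hγbar : γbar * L ^ 2 < 2 * m₂) (hm : m ≤ 0)
    (hone : ∀ x ∈ X, ∀ y ∈ X, inner ℝ (b x - b y) (x - y) ≤ -m * ‖x - y‖ ^ 2)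
    (hΨ : ∀ γ ∈ Ioc 0 γbar, ∀ ℓ : ℕ, 1 ≤ ℓ → ∀ t : ℝ, 0 ≤ t → Ψ γ ℓ t ∈ Icc (0 : ℝ) 1)
    (hmin : ∀ γ ∈ Ioc 0 γbar, ∀ ℓ : ℕ, 1 ≤ ℓ → ∀ x y : X,
      (reflectionCouplingKernel X ⟨0, h0⟩ b γ ^ (ℓ * ⌈1 / γ⌉₊)) (x, y) (diagonal X)ᶜ
        ≤ ENNReal.ofReal (1 - Ψ γ ℓ ‖(x : Eucl d) - y‖))
    (hpos : ∀ ℓ : ℕ, 1 ≤ ℓ → ∀ M' : ℝ,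
      ∃ δ > 0, ∀ γ ∈ Ioc 0 γbar, ∀ t, 0 ≤ t → t ≤ M' → δ ≤ Ψ γ ℓ t)
    (hlt : ∀ γ, 0 < γ → ∀ ℓ : ℕ, 1 ≤ ℓ → ∀ t, 0 < t → Ψ γ ℓ t < 1) :
    ConvergenceFor X ⟨0, h0⟩ b γbar (driftLam m₂ L γbar) (driftA d R₂ m₂ m) Ψ := by
  have hX : X.Nonempty := ⟨0, h0⟩
  have hl : 0 < driftLam m₂ L γbar := Real.exp_pos _
  have hl1 : driftLam m₂ L γbar < 1 := by rw [driftLam, Real.exp_lt_one_iff]; linarith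
  have hA : 1 ≤ driftA d R₂ m₂ m := by
    have h1 : (1 : ℝ) ≤ d := by exact_mod_cast hd
    have h2 : 0 ≤ 2 * R₂ ^ 2 * (m₂ - m) := mul_nonneg (by positivity) (by linarith)
    rw [driftA]; linarith
  set lam := driftLam m₂ L γbar with hlam
  set A := driftA d R₂ m₂ m with hAdef
  have hlog : 0 < Real.log (1 / lam) := Real.log_pos (by rw [lt_div_iff₀ hl]; linarith)
  have hR : 0 < driftRadius lam A γbar := by
    have h1 : 0 < lam ^ (-γbar) := Real.rpow_pos_of_pos hl _
    have h2 : 0 < √A := Real.sqrt_pos.2 (by linarith)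
    have h3 : 0 < √(Real.log (1 / lam)) := Real.sqrt_pos.2 hlog
    rw [driftRadius]; positivity
  set r := driftRadius lam A γbar with hr
  have hmem (M' : ℝ) (hM' : 0 ≤ M') : ((⟨0, h0⟩, ⟨0, h0⟩) : X × X) ∈ closePairs X M' := by
    simpa [closePairs] using hM'
  have hDM : DriftMinorization (projEulerKernel X ⟨0, h0⟩ b)
      (reflectionCouplingKernel X ⟨0, h0⟩ b) γbar lam A (2 * r) (quadLyapunovPair X)
      (ballPair X r) Ψ :=
    { lam_mem := ⟨hl, hl1⟩
      A_nonneg := by linarith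
      M_pos := by linarith
      measurable_V := measurable_quadLyapunovPair
      one_le_V := one_le_quadLyapunovPair
      measurableSet_C := by
        have h1 : Measurable fun p : X × X ↦ ‖(p.1 : Eucl d)‖ := by fun_prop
        have h2 : Measurable fun p : X × X ↦ ‖(p.2 : Eucl d)‖ := by fun_prop
        exact (h1 measurableSet_Iic).inter (h2 measurableSet_Iic)
      C_subset := fun p hp ↦ (norm_sub_le _ _).trans (by linarith [hp.1, hp.2])
      coupling := fun γ hγ ↦ isMarkovCoupling_reflectionCouplingKernel hX hcl hcv hb hγ.1
      drift := fun γ hγ ↦ driftCondition_reflectionCouplingKernel hX hcl hcv hb h0 hbLip hb0 hm₂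
        hm hdiss hone hl1 (by linarith) hγ
      absorbing := fun γ _ x ↦ reflectionCouplingKernel_diagonal hX hcl hcv hb x
      Ψ_mem := hΨ
      minorization := hmin
      inf_Ψ_pos := fun γ hγ ℓ hℓ M' hM' ↦ by
        obtain ⟨δ, hδ, h⟩ := hpos ℓ hℓ M'
        refine hδ.trans_le (le_csInf ⟨_, _, hmem M' hM', rfl⟩ ?_)
        rintro _ ⟨p, hp, rfl⟩
        exact h γ hγ _ (norm_nonneg _) hp }
  have hC : (ballPair X r).Nonempty := ⟨(⟨0, h0⟩, ⟨0, h0⟩), by simp [ballPair, hR.le]⟩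
  have hB : BddAbove (quadLyapunovPair X '' ballPair X r) := by
    refine ⟨1 + r ^ 2 / 2 + r ^ 2 / 2, ?_⟩
    rintro _ ⟨p, hp, rfl⟩
    rw [quadLyapunovPair]
    gcongr
    · exact hp.1
    · exact hp.2
  have hε0 : ∀ ℓ : ℕ, 1 ≤ ℓ → 0 < minorizationConst X γbar (2 * r) Ψ ℓ := by
    intro ℓ hℓ
    obtain ⟨δ, hδ, h⟩ := hpos ℓ hℓ (2 * r)
    refine hδ.trans_le (le_csInf ⟨_, γbar, ⟨hγpos, le_rfl⟩, _, hmem (2 * r) (by linarith), rfl⟩ ?_)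
    rintro _ ⟨γ, hγ, p, hp, rfl⟩
    exact h γ hγ _ (norm_nonneg _) hp
  have hε1 : X.Nontrivial → ∀ ℓ : ℕ, 1 ≤ ℓ → minorizationConst X γbar (2 * r) Ψ ℓ < 1 := by
    intro hnt ℓ hℓ
    obtain ⟨y, hy, hy0⟩ := hnt.exists_ne 0
    have hyn : 0 < ‖y‖ := norm_pos_iff.2 hy0
    -- a point of the segment from `0` to `y`, close enough to `0`
    set s := min 1 (2 * r / ‖y‖) with hs
    have hs0 : 0 < s := lt_min one_pos (by positivity)
    have hsy : s • y ∈ X := by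
      have := hcv h0 hy (sub_nonneg.2 (min_le_left 1 (2 * r / ‖y‖))) hs0.le (by ring)
      simpa using this
    have hnorm : ‖s • y‖ = s * ‖y‖ := by rw [norm_smul, Real.norm_of_nonneg hs0.le]
    have hclose : ((⟨s • y, hsy⟩, ⟨0, h0⟩) : X × X) ∈ closePairs X (2 * r) := by
      change ‖s • y - 0‖ ≤ 2 * r
      rw [sub_zero, hnorm, ← le_div_iff₀ hyn]
      exact min_le_right _ _
    refine (minorizationConst_le hDM ⟨hγpos, le_rfl⟩ hℓ hclose).trans_lt (hlt _ hγpos ℓ hℓ _ ?_)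
    change 0 < ‖s • y - 0‖
    rw [sub_zero, hnorm]
    positivity
  exact ⟨hDM, hDM.quantitativeConvergence hγpos hA hC hB hε0 hε1,
    hDM.uniformGeometricConvergence hγpos hA hC hB hε0 hε1
      (fun x ↦ by rw [quadLyapunov]; positivity) quadLyapunovPair_eq⟩

end Conclusion

theorem theorem16 {d : ℕ} (hd : 1 ≤ d)
    (X : Set (Eucl d)) (hXclosed : IsClosed X) (hXconvex : Convex ℝ X) (h0 : (0 : Eucl d) ∈ X)
    (b : Eucl d → Eucl d) (hbcont : Continuous b)
    -- `b` is `L`-Lipschitz on `X` and vanishes at the origin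
    (L : ℝ) (hL : 0 ≤ L) (hbLip : ∀ x ∈ X, ∀ y ∈ X, ‖b x - b y‖ ≤ L * ‖x - y‖) (hb0 : b 0 = 0)
    -- radial dissipativity outside a ball
    (R₂ m₂ : ℝ) (hR₂ : 0 ≤ R₂) (hm₂ : 0 < m₂)
    (hdiss : ∀ x ∈ X, R₂ < ‖x‖ → inner ℝ (b x) x ≤ -m₂ * ‖x‖ ^ 2)
    -- the maximal step size: `γbar < 2 m₂ / L²`
    (γbar : ℝ) (hγpos : 0 < γbar) (hγ : γbar * L ^ 2 < 2 * m₂) :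
    (∀ m : ℝ, m ≤ 0 →
      (∀ x ∈ X, ∀ y ∈ X, inner ℝ (b x - b y) (x - y) ≤ -m * ‖x - y‖ ^ 2) →
      ConvergenceFor X ⟨0, h0⟩ b γbar (driftLam m₂ L γbar) (driftA d R₂ m₂ m)
        (psiMonotone m L)) ∧
    (∀ mb : ℝ, 0 < mb →
      (∀ x ∈ X, ∀ y ∈ X, inner ℝ (b x - b y) (x - y) ≤ -mb * ‖b x - b y‖ ^ 2) →
      γbar ≤ 2 * mb →
      ∀ ℓ₀ : ℕ,
        (2 * driftRadius (driftLam m₂ L γbar) (driftA d R₂ m₂ 0) γbar) ^ 2 ≤ ℓ₀ →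
        ConvergenceFor X ⟨0, h0⟩ b γbar (driftLam m₂ L γbar) (driftA d R₂ m₂ 0)
          (psiCoercive L
            (2 * driftRadius (driftLam m₂ L γbar) (driftA d R₂ m₂ 0) γbar) ℓ₀)) := by
  refine ⟨fun m hm hone ↦ ?_, fun mb hmb hco hγmb ℓ₀ hℓ₀ ↦ ?_⟩
  · refine convergenceFor_of_minorization hd hXclosed hXconvex h0 hbcont hbLip hb0 hm₂ hdiss hγpos
      hγ hm hone (fun γ _ ℓ _ t ht ↦ psiMonotone_mem ht) (fun γ hγ' ℓ hℓ x y ↦ ?_)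
      (fun ℓ hℓ M' ↦ exists_pos_le_psiMonotone hm hℓ)
      (fun γ hγ' ℓ hℓ t ht ↦ psiMonotone_lt_one hm hγ' hℓ ht)
    exact pow_reflectionCouplingKernel_compl_le_cdf ⟨0, h0⟩ hXclosed hXconvex hbcont hγ'.1
      (one_le_one_add_mul_kappa hm hγ'.1.le)
      (fun x hx y hy ↦ norm_eulerDiff_sq_le_of_oneSided hγ'.1.le hbLip hone hx hy)
      (one_le_mul_ceil hγ'.1 hℓ) x y
  · have hone : ∀ x ∈ X, ∀ y ∈ X, inner ℝ (b x - b y) (x - y) ≤ -0 * ‖x - y‖ ^ 2 := by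
      intro x hx y hy
      have h := hco x hx y hy
      have : 0 ≤ mb * ‖b x - b y‖ ^ 2 := by positivity
      linarith
    refine convergenceFor_of_minorization hd hXclosed hXconvex h0 hbcont hbLip hb0 hm₂ hdiss hγpos
      hγ le_rfl hone (fun γ _ ℓ _ t ht ↦ psiCoercive_mem ht) (fun γ hγ' ℓ hℓ x y ↦ ?_)
      (fun ℓ hℓ M' ↦ exists_pos_le_psiCoercive hℓ)
      (fun γ hγ' ℓ hℓ t ht ↦ psiCoercive_lt_one hγ' hℓ ht)
    rw [psiCoercive]
    split_ifs with hcase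
    · refine (pow_reflectionCouplingKernel_compl_le_cdf ⟨0, h0⟩ hXclosed hXconvex hbcont hγ'.1
        le_rfl (fun x hx y hy ↦ norm_eulerDiff_sq_le_of_coercive hγ'.1.le
          (hγ'.2.trans hγmb) hco hx hy) (one_le_mul_ceil hγ'.1 hℓ) x y).trans
          (ENNReal.ofReal_le_ofReal ?_)
      -- the accumulated variance `γ ℓ ⌈1 / γ⌉` is at least `ℓ ≥ ℓ₀ ≥ M ^ 2 ≥ ‖x - y‖ ^ 2`
      have hvar : (ℓ : ℝ) ≤ accumulatedVar γ 1 (ℓ * ⌈1 / γ⌉₊) := by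
        refine (le_mul_ceil hγ'.1 ℓ).trans ?_
        simpa using le_accumulatedVar hγ'.1.le le_rfl (ℓ * ⌈1 / γ⌉₊)
      have hℓ' : (ℓ₀ : ℝ) ≤ ℓ := by exact_mod_cast hcase.1
      have hℓ0 : (0 : ℝ) < ℓ := by exact_mod_cast hℓ
      have hsqrt : ‖(x : Eucl d) - y‖ ≤ √(accumulatedVar γ 1 (ℓ * ⌈1 / γ⌉₊)) := by
        refine Real.le_sqrt_of_sq_le ?_
        have := pow_le_pow_left₀ (norm_nonneg _) hcase.2 2
        linarith
      have hpos : 0 < √(accumulatedVar γ 1 (ℓ * ⌈1 / γ⌉₊)) := Real.sqrt_pos.2 (by linarith)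
      have hle : ‖(x : Eucl d) - y‖ / (2 * √(accumulatedVar γ 1 (ℓ * ⌈1 / γ⌉₊))) ≤ 1 / 2 := by
        rw [div_le_div_iff₀ (by positivity) (by norm_num)]
        linarith
      linarith [monotone_stdNormalCdf (neg_le_neg hle)]
    · exact pow_reflectionCouplingKernel_compl_le_cdf ⟨0, h0⟩ hXclosed hXconvex hbcont hγ'.1
        (one_le_one_add_mul_kappa le_rfl hγ'.1.le)
        (fun x hx y hy ↦ norm_eulerDiff_sq_le_of_oneSided hγ'.1.le hbLip hone hx hy)
        (one_le_mul_ceil hγ'.1 hℓ) x y
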